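/- Let \(k\) be a field. Let \(\mathrm{FinRel}_k\) be the symmetric monoidal category whose objects are the finite-dimensional vector spaces over \(k\), whose morphisms \(L\colon U\nrightarrow V\) are the linear relations, i.e. the linear subspaces \(L\subseteq U\oplus V\), with composition \(L'L=\{(u,w):\exists v,\ (u,v)\in L,\ (v,w)\in L'\}\), with direct sum \(\oplus\) as tensor product, unit object \(\{0\}\), and the usual braiding. As usual we identify \(k^m\oplus k^n\) with \(k^{m+n}\) (that is, we work in a strict version of \(\mathrm{FinRel}_k\)). Consider the following generating morphisms: addition \(+\colon k^2\nrightarrow k\), zero \(0\colon\{0\}\nrightarrow k\), duplication \(\Delta\colon k\nrightarrow k^2\), \(x\mapsto(x,x)\), deletion \(!\colon k\nrightarrow\{0\}\), scalar multiplication \(c\colon k\nrightarrow k\) for each \(c\in k\) (all of these are graphs of linear maps), cup \(\cup=\{((x,x),0)\}\colon k^2\nrightarrow\{0\}\) and cap \(\cap=\{(0,(x,x))\}\colon\{0\}\nrightarrow k^2\). A formal morphism \(k^m\to k^n\) is a formal expression built from symbols for these generators via composition, identity morphisms, tensor product, the unit object and the braiding \(B\); it evaluates to a linear relation \(k^m\nrightarrow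 k^n\). Write \(1\) for the identity of \(k\) and \(1_0\) for the identity of the unit object. For formal morphisms, let \(\cup_2=\cup(1\oplus\cup\oplus1)\) and \(\cap_2=(1\oplus\cap\oplus1)\cap\) be the nested cups and caps, and define the adjoints \[+^\dagger=(1\oplus1\oplus\cup)(1\oplus1\oplus{+}\oplus1)(\cap_2\oplus1),\qquad 0^\dagger=\cup(0\oplus1),\] \[\Delta^\dagger=(\cup_2\oplus1)(1\oplus1\oplus\Delta\oplus1)(1\oplus1\oplus\cap),\qquad {!}^\dagger=({!}\oplus1)\cap,\qquad c^\dagger=(\cup\oplus1)(1\oplus c\oplus1)(1\oplus\cap).\] Let \(R\) consist of the following relations between formal morphisms, for all \(b,c\in k\), where \(b+c\), \(bc\), \(0_k\), \(1_k\), \(-1\), \(c^{-1}\) denote the multiplications by the indicated scalars: (1)–(3) \(+(0\oplus1)=1\), \(\ +(1\oplus+)=+(+\oplus1)\), \(\ +B=+\); (4)–(6) \(({!}\oplus1)\Delta=1\), \(\ (1\oplus\Delta)\Delta=(\Delta\oplus1)\Delta\), \(\ B\Delta=\Delta\); (7)–(10) \(\Delta+=(+\oplus+)(1\oplus B\oplus1)(\Delta\oplus\Delta)\),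 \(\ \Delta0=0\oplus0\), \(\ {!}+={!}\oplus{!}\), \(\ {!}\,0=1_0\); (11)–(14) \(bc=b\circ c\), \(\ b+c=+(b\oplus c)\Delta\), \(\ 1_k=1\), \(\ 0_k=0\circ{!}\); (15)–(18) \(+(c\oplus c)=c\,+\), \(\ c\,0=0\), \(\ (c\oplus c)\Delta=\Delta c\), \(\ {!}\,c={!}\); (19)–(20) \((\cup\oplus1)(1\oplus\cap)=1=(1\oplus\cup)(\cap\oplus1)\); (21)–(22) \((+\oplus1)(1\oplus+^\dagger)=+^\dagger+=(1\oplus+)(+^\dagger\oplus1)\); (23)–(24) \((\Delta^\dagger\oplus1)(1\oplus\Delta)=\Delta\Delta^\dagger=(1\oplus\Delta^\dagger)(\Delta\oplus1)\); (25)–(28) \(+\,+^\dagger=1\), \(\ 0^\dagger0=1_0\), \(\ \Delta^\dagger\Delta=1\), \(\ {!}\,{!}^\dagger=1_0\); (29)–(31) \(\cup((-1)\oplus1)=0^\dagger+\), \(\ \cap=\Delta\,{!}^\dagger\), \(\ c^\dagger=c^{-1}\) for \(c\neq0\). Then the symmetric monoidal category \(\mathrm{FinRel}_k\) is presented by the object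 \(k\), these generating morphisms and the relations \(R\). That is: (a) \(k\) and the generating morphisms generate \(\mathrm{FinRel}_k\): the inclusion of the smallest subcategory that contains \(k\) and the generating morphisms and is closed under tensor products of objects and morphisms and contains the braidings of its objects is an equivalence of categories; (b) all relations in \(R\) hold in \(\mathrm{FinRel}_k\); (c) two formal morphisms \(k^m\to k^n\) evaluate to the same linear relation if and only if one can go from one to the other by finitely many moves, each of which replaces an instance of one side of a relation in \(R\) by the other side or applies an equational law in the definition of a strict symmetric monoidal category. -/

import Mathlib

open CategoryTheory MonoidalCategory

universe u

/-! ## The symmetric monoidal category of linear relations -/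

/-- An object of `FinRel k`: a finite-dimensional vector space over `k`. -/
structure FinRel (k : Type u) [Field k] where
  carrier : Type u
  [addCommGroup : AddCommGroup carrier]
  [module : Module k carrier]
  [finiteDimensional : FiniteDimensional k carrier]

namespace FinRel

attribute [instance] addCommGroup module finiteDimensional

variable {k : Type u} [Field k]

/-- A morphism `U ⟶ V` of `FinRel k`: a linear relation, that is, a linear subspace of `U ⊕ V`. -/
@[ext]
structure Hom (U V : FinRel k) where
  rel : Submodule k (U.carrier × V.carrier)

/-- Composition of linear relations: `u` is related to `w` iff there is a `v` such that `u` is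
related to `v` and `v` is related to `w`. -/
def compRel {U V W : Type u} [AddCommGroup U] [AddCommGroup V] [AddCommGroup W]
    [Module k U] [Module k V] [Module k W]
    (L : Submodule k (U × V)) (M : Submodule k (V × W)) : Submodule k (U × W) where
  carrier := {p | ∃ v, (p.1, v) ∈ L ∧ (v, p.2) ∈ M}
  add_mem' := by
    rintro p q ⟨v, hv, hv'⟩ ⟨w, hw, hw'⟩
    exact ⟨v + w, L.add_mem hv hw, M.add_mem hv' hw'⟩
  zero_mem' := ⟨0, L.zero_mem, M.zero_mem⟩
  smul_mem' := by
    rintro c p ⟨v, hv, hv'⟩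
    exact ⟨c • v, L.smul_mem c hv, M.smul_mem c hv'⟩

/-- Direct sum of linear relations. -/
def sumRel {U V U' V' : Type u} [AddCommGroup U] [AddCommGroup V] [AddCommGroup U']
    [AddCommGroup V'] [Module k U] [Module k V] [Module k U'] [Module k V']
    (L : Submodule k (U × V)) (M : Submodule k (U' × V')) :
    Submodule k ((U × U') × (V × V')) where
  carrier := {p | (p.1.1, p.2.1) ∈ L ∧ (p.1.2, p.2.2) ∈ M}
  add_mem' := by
    rintro p q ⟨h, h'⟩ ⟨i, i'⟩
    exact ⟨L.add_mem h i, M.add_mem h' i'⟩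
  zero_mem' := ⟨L.zero_mem, M.zero_mem⟩
  smul_mem' := by
    rintro c p ⟨h, h'⟩
    exact ⟨L.smul_mem c h, M.smul_mem c h'⟩

instance : Category (FinRel k) where
  Hom := Hom
  id U := ⟨(LinearMap.id : U.carrier →ₗ[k] U.carrier).graph⟩
  comp L M := ⟨compRel L.rel M.rel⟩
  id_comp L := by
    apply Hom.ext; ext ⟨x, y⟩
    constructor
    · rintro ⟨v, hv, h⟩
      obtain rfl : v = x := hv
      exact h
    · exact fun h => ⟨x, rfl, h⟩
  comp_id L := by
    apply Hom.ext; ext ⟨x, y⟩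
    constructor
    · rintro ⟨v, h, hv⟩
      obtain rfl : y = v := hv
      exact h
    · exact fun h => ⟨y, h, rfl⟩
  assoc L M N := by
    apply Hom.ext; ext ⟨x, y⟩
    constructor
    · rintro ⟨v, ⟨w, h₁, h₂⟩, h₃⟩
      exact ⟨w, h₁, v, h₂, h₃⟩
    · rintro ⟨v, h₁, w, h₂, h₃⟩
      exact ⟨w, ⟨v, h₁, h₂⟩, h₃⟩

@[ext]
theorem hom_ext {U V : FinRel k} {L M : U ⟶ V}
    (h : ∀ x y, (x, y) ∈ L.rel ↔ (x, y) ∈ M.rel) : L = M := by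
  apply Hom.ext; ext ⟨x, y⟩; exact h x y

theorem mem_id {U : FinRel k} (x y : U.carrier) : (x, y) ∈ (𝟙 U : U ⟶ U).rel ↔ y = x :=
  Iff.rfl

theorem mem_comp {U V W : FinRel k} (L : U ⟶ V) (M : V ⟶ W) (x : U.carrier) (z : W.carrier) :
    (x, z) ∈ (L ≫ M).rel ↔ ∃ y, (x, y) ∈ L.rel ∧ (y, z) ∈ M.rel :=
  Iff.rfl

/-- The graph of a linear map, as a linear relation. -/
def ofLinearMap {U V : FinRel k} (f : U.carrier →ₗ[k] V.carrier) : U ⟶ V :=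
  Hom.mk f.graph

theorem mem_ofLinearMap {U V : FinRel k} (f : U.carrier →ₗ[k] V.carrier) (x : U.carrier)
    (y : V.carrier) : (x, y) ∈ (ofLinearMap f).rel ↔ y = f x :=
  Iff.rfl

/-- The isomorphism in `FinRel k` given by the graph of a linear equivalence. -/
def isoOfEquiv {U V : FinRel k} (e : U.carrier ≃ₗ[k] V.carrier) : U ≅ V where
  hom := ofLinearMap e.toLinearMap
  inv := ofLinearMap e.symm.toLinearMap
  hom_inv_id := by
    ext x y
    simp [mem_comp, mem_id, mem_ofLinearMap]
  inv_hom_id := by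
    ext x y
    simp [mem_comp, mem_id, mem_ofLinearMap]

/-- Direct sum as tensor product, with the `0`-dimensional space as unit object, and with the
graphs of the usual linear isomorphisms as structure isomorphisms. -/
instance : MonoidalCategoryStruct (FinRel k) where
  tensorObj U V := ⟨U.carrier × V.carrier⟩
  tensorHom L M := ⟨sumRel L.rel M.rel⟩
  whiskerLeft U _ _ L := ⟨sumRel (𝟙 U : U ⟶ U).rel L.rel⟩
  whiskerRight L U := ⟨sumRel L.rel (𝟙 U : U ⟶ U).rel⟩
  tensorUnit := ⟨PUnit⟩
  associator U V W := isoOfEquiv (LinearEquiv.prodAssoc k U.carrier V.carrier W.carrier)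
  leftUnitor _ := isoOfEquiv LinearEquiv.uniqueProd
  rightUnitor _ := isoOfEquiv LinearEquiv.prodUnique

theorem mem_tensorHom {U V U' V' : FinRel k} (L : U ⟶ V) (M : U' ⟶ V')
    (x : U.carrier × U'.carrier) (y : V.carrier × V'.carrier) :
    ((x, y) : (U ⊗ U').carrier × (V ⊗ V').carrier) ∈ (L ⊗ₘ M).rel ↔
      (x.1, y.1) ∈ L.rel ∧ (x.2, y.2) ∈ M.rel :=
  Iff.rfl

theorem ofLinearMap_id (U : FinRel k) :
    ofLinearMap (LinearMap.id : U.carrier →ₗ[k] U.carrier) = 𝟙 U :=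
  rfl

theorem ofLinearMap_comp {U V W : FinRel k} (f : U.carrier →ₗ[k] V.carrier)
    (g : V.carrier →ₗ[k] W.carrier) :
    (ofLinearMap f : U ⟶ V) ≫ (ofLinearMap g : V ⟶ W) = ofLinearMap (g ∘ₗ f) := by
  ext x z
  simp [mem_comp, mem_ofLinearMap]

theorem ofLinearMap_tensor {U V U' V' : FinRel k} (f : U.carrier →ₗ[k] V.carrier)
    (g : U'.carrier →ₗ[k] V'.carrier) :
    (ofLinearMap f : U ⟶ V) ⊗ₘ (ofLinearMap g : U' ⟶ V') =
      (ofLinearMap (f.prodMap g) : U ⊗ U' ⟶ V ⊗ V') := by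
  ext x y
  exact (Prod.ext_iff (x := y) (y := (f x.1, g x.2))).symm

theorem mem_ofLinearMap_comp {U V W : FinRel k} (f : U.carrier →ₗ[k] V.carrier) (L : V ⟶ W)
    (x : U.carrier) (z : W.carrier) :
    (x, z) ∈ ((ofLinearMap f : U ⟶ V) ≫ L).rel ↔ (f x, z) ∈ L.rel := by
  simp [mem_comp, mem_ofLinearMap]

theorem mem_comp_equiv {U V W : FinRel k} (e : V.carrier ≃ₗ[k] W.carrier) (L : U ⟶ V)
    (x : U.carrier) (z : W.carrier) :
    (x, z) ∈ (L ≫ (ofLinearMap e.toLinearMap : V ⟶ W)).rel ↔ (x, e.symm z) ∈ L.rel := by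
  simp only [mem_comp, mem_ofLinearMap]
  constructor
  · rintro ⟨y, h, rfl⟩
    simpa using h
  · exact fun h => ⟨_, h, by simp⟩

instance : MonoidalCategory (FinRel k) :=
  MonoidalCategory.ofTensorHom
    (id_tensorHom_id := fun _ _ => ofLinearMap_tensor _ _)
    (id_tensorHom := fun _ _ _ _ => rfl)
    (tensorHom_id := fun _ _ => rfl)
    (tensorHom_comp_tensorHom := by
      intro _ _ _ _ _ _ f₁ f₂ g₁ g₂
      ext x y
      constructor
      · rintro ⟨v, ⟨h₁, h₂⟩, h₃, h₄⟩
        exact ⟨⟨v.1, h₁, h₃⟩, v.2, h₂, h₄⟩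
      · rintro ⟨⟨v, h₁, h₃⟩, w, h₂, h₄⟩
        exact ⟨(v, w), ⟨h₁, h₂⟩, h₃, h₄⟩)
    (associator_naturality := by
      intro _ _ _ _ _ _ f₁ f₂ f₃
      ext x y
      refine (mem_comp_equiv _ _ _ _).trans (Iff.trans ?_ (mem_ofLinearMap_comp _ _ _ _).symm)
      exact and_assoc)
    (leftUnitor_naturality := by
      intro _ _ f
      ext x y
      refine (mem_comp_equiv _ _ _ _).trans (Iff.trans ?_ (mem_ofLinearMap_comp _ _ _ _).symm)
      exact and_iff_right rfl)
    (rightUnitor_naturality := by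
      intro _ _ f
      ext x y
      refine (mem_comp_equiv _ _ _ _).trans (Iff.trans ?_ (mem_ofLinearMap_comp _ _ _ _).symm)
      exact and_iff_left rfl)
    (pentagon := by
      intro W X Y Z
      rw [← ofLinearMap_id, ← ofLinearMap_id]
      simp only [MonoidalCategoryStruct.associator, isoOfEquiv]
      erw [ofLinearMap_tensor, ofLinearMap_tensor, ofLinearMap_comp, ofLinearMap_comp,
        ofLinearMap_comp]
      rfl)
    (triangle := by
      intro X Y
      rw [← ofLinearMap_id, ← ofLinearMap_id]
      simp only [MonoidalCategoryStruct.associator, MonoidalCategoryStruct.leftUnitor,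
        MonoidalCategoryStruct.rightUnitor, isoOfEquiv]
      erw [ofLinearMap_tensor, ofLinearMap_tensor, ofLinearMap_comp]
      rfl)

instance : SymmetricCategory (FinRel k) where
  braiding U V := isoOfEquiv (LinearEquiv.prodComm k U.carrier V.carrier)
  braiding_naturality_right := by
    intro X Y Z f
    ext x y
    refine (mem_comp_equiv _ _ _ _).trans (Iff.trans ?_ (mem_ofLinearMap_comp _ _ _ _).symm)
    exact and_comm
  braiding_naturality_left := by
    intro X Y f Z
    ext x y
    refine (mem_comp_equiv _ _ _ _).trans (Iff.trans ?_ (mem_ofLinearMap_comp _ _ _ _).symm)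
    exact and_comm
  hexagon_forward := by
    intro X Y Z
    rw [← tensorHom_id, ← id_tensorHom, ← ofLinearMap_id, ← ofLinearMap_id]
    simp only [MonoidalCategoryStruct.associator, isoOfEquiv]
    erw [ofLinearMap_tensor, ofLinearMap_tensor, ofLinearMap_comp, ofLinearMap_comp,
      ofLinearMap_comp, ofLinearMap_comp]
    rfl
  hexagon_reverse := by
    intro X Y Z
    rw [← tensorHom_id, ← id_tensorHom, ← ofLinearMap_id, ← ofLinearMap_id]
    simp only [MonoidalCategoryStruct.associator, isoOfEquiv]
    erw [ofLinearMap_tensor, ofLinearMap_tensor, ofLinearMap_comp, ofLinearMap_comp,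
      ofLinearMap_comp, ofLinearMap_comp]
    rfl
  symmetry := by
    intro X Y
    rw [← ofLinearMap_id]
    exact ofLinearMap_comp _ _

/-! ### The powers of the object `k`

The objects `pow k n` together with the isomorphisms `powIso` (concatenation of tuples, which is
strictly associative and unital) constitute the strict version of `FinRel k`. -/

/-- The object `k ^ n`. -/
def pow (k : Type u) [Field k] (n : ℕ) : FinRel k := ⟨Fin n → k⟩

/-- Concatenation of tuples, as a linear equivalence `k ^ m ⊕ k ^ n ≃ k ^ (m + n)`. -/
def appendEquiv (k : Type u) [Field k] (m n : ℕ) :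
    ((Fin m → k) × (Fin n → k)) ≃ₗ[k] (Fin (m + n) → k) where
  toFun p := Fin.append p.1 p.2
  invFun x := (fun i => x (Fin.castAdd n i), fun i => x (Fin.natAdd m i))
  map_add' p q := by
    funext i
    refine Fin.addCases (fun j => ?_) (fun j => ?_) i <;> simp
  map_smul' c p := by
    funext i
    refine Fin.addCases (fun j => ?_) (fun j => ?_) i <;> simp
  left_inv p := by
    ext i <;> simp
  right_inv x := by
    funext i
    refine Fin.addCases (fun j => ?_) (fun j => ?_) i <;> simp

/-- The identification of `k ^ m ⊕ k ^ n` with `k ^ (m + n)`. -/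
def powIso (k : Type u) [Field k] (m n : ℕ) : pow k m ⊗ pow k n ≅ pow k (m + n) :=
  isoOfEquiv (U := pow k m ⊗ pow k n) (V := pow k (m + n)) (appendEquiv k m n)

/-- The direct sum of two linear relations between powers of `k`. -/
def powTensor {m n p q : ℕ} (L : pow k m ⟶ pow k n) (M : pow k p ⟶ pow k q) :
    pow k (m + p) ⟶ pow k (n + q) :=
  (powIso k m p).inv ≫ (L ⊗ₘ M) ≫ (powIso k n q).hom

/-- The braiding `k ^ m ⊕ k ^ n ⟶ k ^ n ⊕ k ^ m`. -/
def powBraid (k : Type u) [Field k] (m n : ℕ) : pow k (m + n) ⟶ pow k (n + m) :=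
  (powIso k m n).inv ≫ (β_ (pow k m) (pow k n)).hom ≫ (powIso k n m).hom

end FinRel

/-! ## Generating morphisms and formal morphisms -/

/-- Symbols for the generating morphisms. `Gen k m n` consists of the symbols for
generating morphisms from `k ^ m` to `k ^ n`. -/
inductive Gen (k : Type u) : ℕ → ℕ → Type u
  | add : Gen k 2 1
  | zero : Gen k 0 1
  | dup : Gen k 1 2
  | del : Gen k 1 0
  | smul (c : k) : Gen k 1 1
  | cup : Gen k 2 0
  | cap : Gen k 0 2

namespace FinRel

variable {k : Type u} [Field k]

/-- Addition: the graph of `(x, y) ↦ x + y`. -/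
def addRel (k : Type u) [Field k] : Submodule k ((Fin 2 → k) × (Fin 1 → k)) where
  carrier := {p | p.2 0 = p.1 0 + p.1 1}
  add_mem' := by
    rintro ⟨x, y⟩ ⟨x', y'⟩ h h'
    simp_all [add_add_add_comm]
  zero_mem' := by simp
  smul_mem' := by
    rintro d ⟨x, y⟩ h
    simp_all [mul_add]

/-- Zero: the graph of the map `{0} → k`. -/
def zeroRel (k : Type u) [Field k] : Submodule k ((Fin 0 → k) × (Fin 1 → k)) where
  carrier := {p | p.2 0 = 0}
  add_mem' := by
    rintro ⟨x, y⟩ ⟨x', y'⟩ h h'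
    simp_all
  zero_mem' := by simp
  smul_mem' := by
    rintro d ⟨x, y⟩ h
    simp_all

/-- Duplication: the graph of `x ↦ (x, x)`. -/
def dupRel (k : Type u) [Field k] : Submodule k ((Fin 1 → k) × (Fin 2 → k)) where
  carrier := {p | p.2 0 = p.1 0 ∧ p.2 1 = p.1 0}
  add_mem' := by
    rintro ⟨x, y⟩ ⟨x', y'⟩ h h'
    simp_all
  zero_mem' := by simp
  smul_mem' := by
    rintro d ⟨x, y⟩ h
    simp_all

/-- Deletion: the graph of the map `k → {0}`. -/
def delRel (k : Type u) [Field k] : Submodule k ((Fin 1 → k) × (Fin 0 → k)) := ⊤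

/-- Scalar multiplication: the graph of `x ↦ c * x`. -/
def smulRel (k : Type u) [Field k] (c : k) : Submodule k ((Fin 1 → k) × (Fin 1 → k)) where
  carrier := {p | p.2 0 = c * p.1 0}
  add_mem' := by
    rintro ⟨x, y⟩ ⟨x', y'⟩ h h'
    simp_all [mul_add]
  zero_mem' := by simp
  smul_mem' := by
    rintro d ⟨x, y⟩ h
    simp_all [mul_left_comm]

/-- Cup: it holds when the two inputs are equal. -/
def cupRel (k : Type u) [Field k] : Submodule k ((Fin 2 → k) × (Fin 0 → k)) where
  carrier := {p | p.1 0 = p.1 1}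
  add_mem' := by
    rintro ⟨x, y⟩ ⟨x', y'⟩ h h'
    simp_all
  zero_mem' := by simp
  smul_mem' := by
    rintro d ⟨x, y⟩ h
    simp_all

/-- Cap: it holds when the two outputs are equal. -/
def capRel (k : Type u) [Field k] : Submodule k ((Fin 0 → k) × (Fin 2 → k)) where
  carrier := {p | p.2 0 = p.2 1}
  add_mem' := by
    rintro ⟨x, y⟩ ⟨x', y'⟩ h h'
    simp_all
  zero_mem' := by simp
  smul_mem' := by
    rintro d ⟨x, y⟩ h
    simp_all

/-- The linear relations denoted by the symbols for the generating morphisms. -/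
def genRel : {m n : ℕ} → Gen k m n → (pow k m ⟶ pow k n)
  | _, _, .add => Hom.mk (addRel k)
  | _, _, .zero => Hom.mk (zeroRel k)
  | _, _, .dup => Hom.mk (dupRel k)
  | _, _, .del => Hom.mk (delRel k)
  | _, _, .smul c => Hom.mk (smulRel k c)
  | _, _, .cup => Hom.mk (cupRel k)
  | _, _, .cap => Hom.mk (capRel k)

/-- The morphisms of the smallest subcategory of the strict version of `FinRel k` that contains
the object `k` and the generating morphisms and is closed under tensor products of objects and of
morphisms and contains the braidings of its objects. -/
inductive Generated : {m n : ℕ} → (pow k m ⟶ pow k n) → Prop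
  | gen {m n : ℕ} (g : Gen k m n) : Generated (genRel g)
  | id (n : ℕ) : Generated (𝟙 (pow k n))
  | comp {m n p : ℕ} {L : pow k m ⟶ pow k n} {M : pow k n ⟶ pow k p} :
      Generated L → Generated M → Generated (L ≫ M)
  | tensor {m n p q : ℕ} {L : pow k m ⟶ pow k n} {M : pow k p ⟶ pow k q} :
      Generated L → Generated M → Generated (powTensor L M)
  | braid (m n : ℕ) : Generated (powBraid k m n)

/-- The subcategory of `FinRel k` generated by the object `k` and the generating morphisms. Its
objects are the powers `k ^ n`, its morphisms are the generated linear relations. -/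
structure GeneratedSubcategory (k : Type u) [Field k] where
  exponent : ℕ

instance : Category (GeneratedSubcategory k) where
  Hom X Y := {L : pow k X.exponent ⟶ pow k Y.exponent // Generated L}
  id X := ⟨𝟙 _, .id _⟩
  comp L M := ⟨L.1 ≫ M.1, .comp L.2 M.2⟩

/-- The inclusion of the generated subcategory. -/
def GeneratedSubcategory.inclusion (k : Type u) [Field k] :
    GeneratedSubcategory k ⥤ FinRel k where
  obj X := pow k X.exponent
  map L := L.1

end FinRel

/-- Formal morphisms: formal expressions built from the symbols for the generating morphisms via
composition, identity morphisms, tensor product and the braiding. The objects are the tensor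
powers of the one generating object `k`, written as natural numbers, with the unit object `0`. -/
inductive Formal (k : Type u) : ℕ → ℕ → Type u
  | gen {m n : ℕ} (g : Gen k m n) : Formal k m n
  | id (n : ℕ) : Formal k n n
  | comp {m n p : ℕ} (f : Formal k m n) (g : Formal k n p) : Formal k m p
  | tensor {m n p q : ℕ} (f : Formal k m n) (g : Formal k p q) : Formal k (m + p) (n + q)
  | braid (m n : ℕ) : Formal k (m + n) (n + m)

namespace Formal

/-- Composition of formal morphisms, in diagrammatic order: first `f`, then `g`. -/
scoped infixl:60 " ⨾ " => Formal.comp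

/-- Tensor product of formal morphisms: `f` on the left, `g` on the right. -/
scoped infixl:70 " ⊕ᵗ " => Formal.tensor

/-- Rewriting the source and the target of a formal morphism along equalities. -/
def cast {k : Type u} {m m' n n' : ℕ} (hm : m = m') (hn : n = n') (f : Formal k m n) :
    Formal k m' n' :=
  hm ▸ hn ▸ f

/-- Evaluation of a formal morphism in `FinRel k`. -/
def ev {k : Type u} [Field k] : {m n : ℕ} → Formal k m n → (FinRel.pow k m ⟶ FinRel.pow k n)
  | _, _, gen g => FinRel.genRel g
  | _, _, id n => 𝟙 (FinRel.pow k n)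
  | _, _, comp f g => ev f ≫ ev g
  | _, _, tensor f g => FinRel.powTensor (ev f) (ev g)
  | _, _, braid m n => FinRel.powBraid k m n

section generators

variable {k : Type u}

/-- Addition. -/
abbrev add : Formal k 2 1 := gen .add
/-- Zero. -/
abbrev zero : Formal k 0 1 := gen .zero
/-- Duplication. -/
abbrev dup : Formal k 1 2 := gen .dup
/-- Deletion. -/
abbrev del : Formal k 1 0 := gen .del
/-- Multiplication by the scalar `c`. -/
abbrev smul (c : k) : Formal k 1 1 := gen (.smul c)
/-- Cup. -/
abbrev cup : Formal k 2 0 := gen .cup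
/-- Cap. -/
abbrev cap : Formal k 0 2 := gen .cap

/-- Two nested cups, the first wire joined to the fourth and the second to the third. -/
def cup2 : Formal k 4 0 := (id 1 ⊕ᵗ cup ⊕ᵗ id 1 : Formal k 4 2) ⨾ cup

/-- Two nested caps, the first wire joined to the fourth and the second to the third. -/
def cap2 : Formal k 0 4 := cap ⨾ (id 1 ⊕ᵗ cap ⊕ᵗ id 1 : Formal k 2 4)

/-- Coaddition: addition turned around by means of caps and a cup. -/
def coadd : Formal k 1 2 :=
  (cap2 ⊕ᵗ id 1 : Formal k 1 5) ⨾ (id 2 ⊕ᵗ add ⊕ᵗ id 1 : Formal k 5 4) ⨾ (id 2 ⊕ᵗ cup : Formal k 4 2)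

/-- Cozero: zero turned around by means of a cup. -/
def cozero : Formal k 1 0 := (zero ⊕ᵗ id 1 : Formal k 1 2) ⨾ cup

/-- Coduplication: duplication turned around by means of a cap and cups. -/
def codup : Formal k 2 1 :=
  (id 2 ⊕ᵗ cap : Formal k 2 4) ⨾ (id 2 ⊕ᵗ dup ⊕ᵗ id 1 : Formal k 4 5) ⨾ (cup2 ⊕ᵗ id 1 : Formal k 5 1)

/-- Codeletion: deletion turned around by means of a cap. -/
def codel : Formal k 0 1 := cap ⨾ (del ⊕ᵗ id 1 : Formal k 2 1)

/-- The adjoint of multiplication by `c`: turned around by means of a cap and a cup. -/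
def cosmul (c : k) : Formal k 1 1 :=
  (id 1 ⊕ᵗ cap : Formal k 1 3) ⨾ (id 1 ⊕ᵗ smul c ⊕ᵗ id 1 : Formal k 3 3) ⨾ (cup ⊕ᵗ id 1 : Formal k 3 1)

end generators

/-- The defining relations of the presentation. -/
inductive Relation {k : Type u} [Field k] : {m n : ℕ} → Formal k m n → Formal k m n → Prop
  -- addition and zero make `k` a commutative monoid
  | add_unit : Relation ((zero ⊕ᵗ id 1 : Formal k 1 2) ⨾ add) (id 1)
  | add_assoc : Relation ((id 1 ⊕ᵗ add : Formal k 3 2) ⨾ add) ((add ⊕ᵗ id 1 : Formal k 3 2) ⨾ add)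
  | add_comm : Relation ((braid 1 1 : Formal k 2 2) ⨾ add) add
  -- duplication and deletion make `k` a cocommutative comonoid
  | dup_counit : Relation (dup ⨾ (del ⊕ᵗ id 1 : Formal k 2 1)) (id 1)
  | dup_coassoc :
      Relation (dup ⨾ (id 1 ⊕ᵗ dup : Formal k 2 3)) (dup ⨾ (dup ⊕ᵗ id 1 : Formal k 2 3))
  | dup_cocomm : Relation (dup ⨾ (braid 1 1 : Formal k 2 2)) dup
  -- the monoid and the comonoid form a bimonoid
  | add_dup : Relation (add ⨾ dup)
      ((dup ⊕ᵗ dup : Formal k 2 4) ⨾ (id 1 ⊕ᵗ braid 1 1 ⊕ᵗ id 1 : Formal k 4 4) ⨾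
        (add ⊕ᵗ add : Formal k 4 2))
  | zero_dup : Relation (zero ⨾ dup) (zero ⊕ᵗ zero)
  | add_del : Relation (add ⨾ del) (del ⊕ᵗ del)
  | zero_del : Relation (zero ⨾ del) (id 0)
  -- the rig structure of `k`
  | smul_mul (b c : k) : Relation (smul (b * c)) (smul c ⨾ smul b)
  | smul_add (b c : k) :
      Relation (smul (b + c)) (dup ⨾ (smul b ⊕ᵗ smul c : Formal k 2 2) ⨾ add)
  | smul_one : Relation (smul 1) (id 1)
  | smul_zero : Relation (smul 0) (del ⨾ zero)
  -- scalar multiplication commutes with addition, zero, duplication and deletion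
  | add_smul (c : k) : Relation ((smul c ⊕ᵗ smul c : Formal k 2 2) ⨾ add) (add ⨾ smul c)
  | zero_smul (c : k) : Relation (zero ⨾ smul c) zero
  | dup_smul (c : k) : Relation (dup ⨾ (smul c ⊕ᵗ smul c : Formal k 2 2)) (smul c ⨾ dup)
  | del_smul (c : k) : Relation (smul c ⨾ del) del
  -- the zigzag relations
  | zigzag_left :
      Relation ((id 1 ⊕ᵗ cap : Formal k 1 3) ⨾ (cup ⊕ᵗ id 1 : Formal k 3 1)) (id 1)
  | zigzag_right :
      Relation ((cap ⊕ᵗ id 1 : Formal k 1 3) ⨾ (id 1 ⊕ᵗ cup : Formal k 3 1)) (id 1)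
  -- addition, zero, coaddition and cozero form a Frobenius monoid
  | add_frobenius_left :
      Relation ((id 1 ⊕ᵗ coadd : Formal k 2 3) ⨾ (add ⊕ᵗ id 1 : Formal k 3 2)) (add ⨾ coadd)
  | add_frobenius_right :
      Relation (add ⨾ coadd) ((coadd ⊕ᵗ id 1 : Formal k 2 3) ⨾ (id 1 ⊕ᵗ add : Formal k 3 2))
  -- coduplication, codeletion, duplication and deletion form a Frobenius monoid
  | dup_frobenius_left :
      Relation ((id 1 ⊕ᵗ dup : Formal k 2 3) ⨾ (codup ⊕ᵗ id 1 : Formal k 3 2)) (codup ⨾ dup)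
  | dup_frobenius_right :
      Relation (codup ⨾ dup) ((dup ⊕ᵗ id 1 : Formal k 2 3) ⨾ (id 1 ⊕ᵗ codup : Formal k 3 2))
  -- these two Frobenius monoids are extra-special
  | add_special : Relation (coadd ⨾ add) (id 1)
  | add_extra : Relation (zero ⨾ cozero) (id 0)
  | dup_special : Relation (dup ⨾ codup) (id 1)
  | dup_extra : Relation (codel ⨾ del) (id 0)
  -- cup with a factor `-1`, and cap
  | cup_eq : Relation ((smul (-1) ⊕ᵗ id 1 : Formal k 2 2) ⨾ cup) (add ⨾ cozero)
  | cap_eq : Relation cap (codel ⨾ dup)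
  -- the adjoint of multiplication by a nonzero scalar
  | smul_inv (c : k) (hc : c ≠ 0) : Relation (cosmul c) (smul c⁻¹)

/-- `Moves f g`: one can go from `f` to `g` by finitely many moves, each of which replaces an
instance of one side of a defining relation by the other, or applies an equational law in the
definition of a strict symmetric monoidal category. -/
inductive Moves {k : Type u} [Field k] : {m n : ℕ} → Formal k m n → Formal k m n → Prop
  | relation {m n : ℕ} {f g : Formal k m n} : Relation f g → Moves f g
  -- equivalence relation, compatible with composition and tensor product
  | refl {m n : ℕ} (f : Formal k m n) : Moves f f
  | symm {m n : ℕ} {f g : Formal k m n} : Moves f g → Moves g f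
  | trans {m n : ℕ} {f g h : Formal k m n} : Moves f g → Moves g h → Moves f h
  | comp_congr {m n p : ℕ} {f f' : Formal k m n} {g g' : Formal k n p} :
      Moves f f' → Moves g g' → Moves (f ⨾ g) (f' ⨾ g')
  | tensor_congr {m n p q : ℕ} {f f' : Formal k m n} {g g' : Formal k p q} :
      Moves f f' → Moves g g' → Moves (f ⊕ᵗ g) (f' ⊕ᵗ g')
  -- category
  | id_comp {m n : ℕ} (f : Formal k m n) : Moves (id m ⨾ f) f
  | comp_id {m n : ℕ} (f : Formal k m n) : Moves (f ⨾ id n) f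
  | assoc {m n p q : ℕ} (f : Formal k m n) (g : Formal k n p) (h : Formal k p q) :
      Moves (f ⨾ g ⨾ h) (f ⨾ (g ⨾ h))
  -- the tensor product is a functor
  | tensor_id (m n : ℕ) : Moves (id m ⊕ᵗ id n) (id (m + n))
  | interchange {m n p m' n' p' : ℕ} (f : Formal k m n) (g : Formal k n p)
      (f' : Formal k m' n') (g' : Formal k n' p') :
      Moves ((f ⨾ g) ⊕ᵗ (f' ⨾ g')) ((f ⊕ᵗ f') ⨾ (g ⊕ᵗ g'))
  -- the tensor product is strictly associative and unital
  | tensor_assoc {m n p m' n' p' : ℕ} (f : Formal k m m') (g : Formal k n n')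
      (h : Formal k p p') :
      Moves (cast (Nat.add_assoc m n p) (Nat.add_assoc m' n' p') (f ⊕ᵗ g ⊕ᵗ h)) (f ⊕ᵗ (g ⊕ᵗ h))
  | unit_tensor {m n : ℕ} (f : Formal k m n) :
      Moves (cast (Nat.zero_add m) (Nat.zero_add n) (id 0 ⊕ᵗ f)) f
  | tensor_unit {m n : ℕ} (f : Formal k m n) :
      Moves (cast (Nat.add_zero m) (Nat.add_zero n) (f ⊕ᵗ id 0)) f
  -- the braiding is natural, satisfies the hexagon identities, and is a symmetry
  | braid_natural {m n m' n' : ℕ} (f : Formal k m m') (g : Formal k n n') :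
      Moves ((f ⊕ᵗ g) ⨾ braid m' n') (braid m n ⨾ (g ⊕ᵗ f))
  | hexagon_forward (m n p : ℕ) :
      Moves (cast (Nat.add_assoc m n p).symm (Nat.add_assoc n p m) (braid m (n + p)))
        ((braid m n ⊕ᵗ id p) ⨾
          cast (Nat.add_assoc n m p).symm rfl (id n ⊕ᵗ braid m p))
  | hexagon_reverse (m n p : ℕ) :
      Moves (cast (Nat.add_assoc m n p) (Nat.add_assoc p m n).symm (braid (m + n) p))
        ((id m ⊕ᵗ braid n p) ⨾
          cast (Nat.add_assoc m p n) rfl (braid m p ⊕ᵗ id n))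
  | braid_symm (m n : ℕ) : Moves (braid m n ⨾ braid n m) (id (m + n))

end Formal

/-!
Part (a), apart from fullness, and part (b) are direct computations; fullness and the completeness
in part (c) rest on the following argument.

Formal morphisms up to moves are the morphisms of a symmetric monoidal category `Syn k` with one
object for each natural number, and evaluation is well defined on it (`Formal.ev_eq_of_moves`).
Completeness means that evaluation is faithful on `Syn k` (`Syn.hom_ext`).

*Linear maps.* The morphisms that are built without cups and caps (`Syn.Lin`) denote linear maps.
By the bimonoid relations, duplication and deletion are natural on them, so tensor products of
objects behave as cartesian products, and a linear morphism is determined by its components. Each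
component can be rewritten into a normal form `row n a`, a linear functional with coefficients `a`
(`Syn.Lin.exists_comp_row`), and so it is determined by the linear relation that it denotes. Hence
linear morphisms are the same as linear maps (`Syn.Lin.ext`, `Syn.exists_lin`).

*Systems of equations.* An effect is a morphism to the unit object. A linear morphism `f` followed
by cozeros is the effect that says `f x = 0`, a system of linear equations. The Frobenius relations
give `Syn.dup_cozero`: if one copy of `x` is zero, the other copy is the state zero. So equations
that follow from a system can be added to it and removed from it (`Syn.conj_cozeros`), and two
systems with the same solutions are equal as effects (`Syn.comp_cozeros_eq`).

*Elimination.* Every effect is a system of linear equations (`Syn.isSystem`), by induction on its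
formal expression: a cup adds the equation `-x + y = 0`, and a cap is codeletion followed by
duplication, where codeletion binds a variable by an existential quantifier. That variable is
eliminated as in Gaussian elimination (`Syn.IsSystem.codel`): either it does not occur, or one
equation can be solved for it and, by `Syn.codel_add_cozero`, disappears together with it. So
effects are determined by their linear relations (`Syn.effect_ext`).

*Bending.* Cups and caps turn outputs into inputs, reversibly by the zigzag relations. This reduces
arbitrary morphisms to effects, both for `Syn.hom_ext` and for the fact that every linear relation
is denoted by a morphism (`Syn.exists_ev_eq`), which yields fullness in part (a).
-/

universe v

/-! ### The syntactic category -/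

/-- The objects of the syntactic category: the tensor powers of one generating object `k`,
recorded by their exponent. -/
structure Syn (k : Type u) where
  exponent : ℕ

namespace Syn

open Formal

variable {k : Type u} [Field k]

/-- Formal morphisms up to moves. -/
instance movesSetoid (k : Type u) [Field k] (m n : ℕ) : Setoid (Formal k m n) where
  r := Moves
  iseqv := ⟨.refl, .symm, .trans⟩

/-- The morphisms of the syntactic category are the formal morphisms up to moves. -/
instance : Category (Syn k) where
  Hom X Y := Quotient (movesSetoid k X.exponent Y.exponent)
  id X := ⟦.id X.exponent⟧
  comp := Quotient.map₂ .comp fun _ _ h _ _ h' => .comp_congr h h'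
  id_comp := by rintro _ _ ⟨f⟩; exact Quotient.sound (.id_comp f)
  comp_id := by rintro _ _ ⟨f⟩; exact Quotient.sound (.comp_id f)
  assoc := by rintro _ _ _ _ ⟨f⟩ ⟨g⟩ ⟨h⟩; exact Quotient.sound (.assoc f g h)

/-- The class of a formal morphism. -/
def cls {m n : ℕ} (f : Formal k m n) : (⟨m⟩ : Syn k) ⟶ ⟨n⟩ := (⟦f⟧ : Quotient (movesSetoid k m n))

theorem cls_eq_cls_iff {m n : ℕ} {f g : Formal k m n} : cls f = cls g ↔ Moves f g := Quotient.eq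

theorem cls_surjective {X Y : Syn k} (f : X ⟶ Y) :
    ∃ g : Formal k X.exponent Y.exponent, cls g = f := Quotient.exists_rep f

theorem cls_comp {m n p : ℕ} (f : Formal k m n) (g : Formal k n p) :
    cls (f ⨾ g) = cls f ≫ cls g := rfl

theorem cls_cast {m m' n n' : ℕ} (hm : m = m') (hn : n = n') (f : Formal k m n) :
    cls (f.cast hm hn) = eqToHom (by rw [hm]) ≫ cls f ≫ eqToHom (by rw [hn]) := by
  subst hm hn; simp; rfl

instance : MonoidalCategoryStruct (Syn k) where
  tensorObj X Y := ⟨X.exponent + Y.exponent⟩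
  tensorHom := Quotient.map₂ .tensor fun _ _ h _ _ h' => .tensor_congr h h'
  whiskerLeft X _ _ :=
    Quotient.map (.tensor (.id X.exponent)) fun _ _ h => .tensor_congr (.refl _) h
  whiskerRight f X :=
    Quotient.map (fun f => .tensor f (.id X.exponent)) (fun _ _ h => .tensor_congr h (.refl _)) f
  tensorUnit := ⟨0⟩
  associator _ _ _ := eqToIso (congrArg Syn.mk (Nat.add_assoc _ _ _))
  leftUnitor _ := eqToIso (congrArg Syn.mk (Nat.zero_add _))
  rightUnitor _ := eqToIso (congrArg Syn.mk (Nat.add_zero _))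

theorem cls_tensor {m n p q : ℕ} (f : Formal k m n) (g : Formal k p q) :
    cls (f ⊕ᵗ g) = cls f ⊗ₘ cls g := rfl

-- The structure isomorphisms come from equalities of exponents. Whenever the two exponents agree by
-- computation, as for `(m + n) + 1` and `m + (n + 1)`, the structure isomorphism is an identity by
-- definition, and `Category.id_comp` removes it.
theorem associator_eq (X Y Z : Syn k) :
    α_ X Y Z = eqToIso (congrArg Syn.mk (Nat.add_assoc _ _ _)) := rfl

theorem leftUnitor_eq (X : Syn k) : λ_ X = eqToIso (congrArg Syn.mk (Nat.zero_add _)) := rfl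

theorem rightUnitor_eq (X : Syn k) : ρ_ X = eqToIso (congrArg Syn.mk (Nat.add_zero _)) := rfl

theorem id_tensor_id (X Y : Syn k) : 𝟙 X ⊗ₘ 𝟙 Y = 𝟙 (X ⊗ Y) :=
  Quotient.sound (.tensor_id X.exponent Y.exponent)

theorem eqToHom_tensor_eqToHom {X X' Y Y' : Syn k} (h : X = X') (h' : Y = Y') :
    eqToHom h ⊗ₘ eqToHom h' = eqToHom (by rw [h, h']) := by
  subst h h'; exact id_tensor_id X Y

theorem comp_eqToHom_of_eq {X X' Y Y' : Syn k} {h : X' = X} {h' : Y = Y'} {f : X ⟶ Y}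
    {g : X' ⟶ Y'} (e : eqToHom h ≫ f ≫ eqToHom h' = g) :
    f ≫ eqToHom h' = eqToHom h.symm ≫ g := by
  subst h h'; simpa using e

instance : MonoidalCategory (Syn k) :=
  MonoidalCategory.ofTensorHom
    (id_tensorHom_id := id_tensor_id)
    (id_tensorHom := by rintro _ _ _ ⟨f⟩; rfl)
    (tensorHom_id := by rintro _ _ ⟨f⟩ _; rfl)
    (tensorHom_comp_tensorHom := by
      rintro _ _ _ _ _ _ ⟨f⟩ ⟨f'⟩ ⟨g⟩ ⟨g'⟩
      exact (Quotient.sound (Moves.interchange f g f' g')).symm)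
    (associator_naturality := by
      intro _ _ _ _ _ _ f g h
      obtain ⟨f, rfl⟩ := cls_surjective f
      obtain ⟨g, rfl⟩ := cls_surjective g
      obtain ⟨h, rfl⟩ := cls_surjective h
      exact comp_eqToHom_of_eq
        ((cls_cast _ _ _).symm.trans (cls_eq_cls_iff.2 (.tensor_assoc f g h))))
    (leftUnitor_naturality := by
      intro _ _ f
      obtain ⟨f, rfl⟩ := cls_surjective f
      exact comp_eqToHom_of_eq ((cls_cast _ _ _).symm.trans (cls_eq_cls_iff.2 (.unit_tensor f))))
    (rightUnitor_naturality := by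
      intro _ _ f
      obtain ⟨f, rfl⟩ := cls_surjective f
      exact comp_eqToHom_of_eq ((cls_cast _ _ _).symm.trans (cls_eq_cls_iff.2 (.tensor_unit f))))
    (pentagon := by
      intro W X Y Z
      simp only [associator_eq, eqToIso.hom, ← eqToHom_refl, eqToHom_tensor_eqToHom,
        eqToHom_trans])
    (triangle := by
      intro X Y
      simp only [associator_eq, leftUnitor_eq, rightUnitor_eq, eqToIso.hom, ← eqToHom_refl,
        eqToHom_tensor_eqToHom, eqToHom_trans])

/-- The class of the formal braiding, as an isomorphism. -/
def braidIso (X Y : Syn k) : X ⊗ Y ≅ Y ⊗ X where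
  hom := cls (.braid X.exponent Y.exponent)
  inv := cls (.braid Y.exponent X.exponent)
  hom_inv_id := cls_eq_cls_iff.2 (.braid_symm _ _)
  inv_hom_id := cls_eq_cls_iff.2 (.braid_symm _ _)

theorem braid_natural {X X' Y Y' : Syn k} (f : X ⟶ X') (g : Y ⟶ Y') :
    (f ⊗ₘ g) ≫ (braidIso X' Y').hom = (braidIso X Y).hom ≫ (g ⊗ₘ f) := by
  obtain ⟨f, rfl⟩ := cls_surjective f
  obtain ⟨g, rfl⟩ := cls_surjective g
  exact cls_eq_cls_iff.2 (.braid_natural f g)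

instance : SymmetricCategory (Syn k) where
  braiding := braidIso
  braiding_naturality_right X Y Z f := by
    rw [← id_tensorHom, ← tensorHom_id]; exact braid_natural _ _
  braiding_naturality_left f Z := by
    rw [← id_tensorHom, ← tensorHom_id]; exact braid_natural _ _
  hexagon_forward X Y Z := by
    have := (cls_cast _ _ _).symm.trans (cls_eq_cls_iff.2
      (.hexagon_forward (k := k) X.exponent Y.exponent Z.exponent))
    rw [cls_comp, cls_cast, eqToHom_refl, Category.comp_id] at this
    exact this
  hexagon_reverse X Y Z := by
    have := (cls_cast _ _ _).symm.trans (cls_eq_cls_iff.2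
      (.hexagon_reverse (k := k) X.exponent Y.exponent Z.exponent))
    rw [cls_comp, cls_cast, eqToHom_refl, Category.comp_id] at this
    exact this
  symmetry X Y := (braidIso X Y).hom_inv_id

end Syn

/-! ### Evaluation and soundness -/

namespace FinRel

variable {k : Type u} [Field k]

theorem mem_powTensor {m n p q : ℕ} (L : pow k m ⟶ pow k n) (M : pow k p ⟶ pow k q)
    (x : Fin (m + p) → k) (y : Fin (n + q) → k) :
    (x, y) ∈ (powTensor L M).rel ↔
      ((fun i => x (Fin.castAdd p i), fun i => y (Fin.castAdd q i)) : (Fin m → k) × (Fin n → k)) ∈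
          L.rel ∧
        ((fun i => x (Fin.natAdd m i), fun i => y (Fin.natAdd n i)) : (Fin p → k) × (Fin q → k)) ∈
          M.rel := by
  refine (mem_ofLinearMap_comp _ _ _ _).trans ((mem_comp_equiv _ _ _ _).trans ?_)
  rfl

theorem mem_powBraid (m n : ℕ) (x : Fin (m + n) → k) (y : Fin (n + m) → k) :
    (x, y) ∈ (powBraid k m n).rel ↔
      (∀ i, y (Fin.castAdd m i) = x (Fin.natAdd m i)) ∧
        ∀ i, y (Fin.natAdd n i) = x (Fin.castAdd n i) := by
  refine (mem_ofLinearMap_comp _ _ _ _).trans ((mem_comp_equiv _ _ _ _).trans ?_)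
  refine Prod.ext_iff.trans (and_congr funext_iff funext_iff)

end FinRel

namespace Formal

open FinRel

variable {k : Type u} [Field k]

/-- `f.Rel x y`: the linear relation denoted by `f` relates `x` to `y`. -/
def Rel {m n : ℕ} (f : Formal k m n) (x : Fin m → k) (y : Fin n → k) : Prop :=
  (x, y) ∈ f.ev.rel

theorem ev_eq_iff {m n : ℕ} {f g : Formal k m n} : f.ev = g.ev ↔ ∀ x y, f.Rel x y ↔ g.Rel x y :=
  ⟨fun h x y => by rw [Rel, h, Rel], fun h => FinRel.hom_ext h⟩

section rel

variable {m n p q : ℕ}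

theorem rel_cast {m' n' : ℕ} (hm : m = m') (hn : n = n') (f : Formal k m n)
    (x : Fin m' → k) (y : Fin n' → k) :
    (f.cast hm hn).Rel x y ↔ f.Rel (fun i => x (Fin.cast hm i)) fun i => y (Fin.cast hn i) := by
  subst hm hn; rfl

theorem rel_id {x y : Fin n → k} : (id n : Formal k n n).Rel x y ↔ y = x := Iff.rfl

theorem rel_comp {f : Formal k m n} {g : Formal k n p} {x : Fin m → k} {z : Fin p → k} :
    (f ⨾ g).Rel x z ↔ ∃ y, f.Rel x y ∧ g.Rel y z := Iff.rfl

theorem rel_tensor {f : Formal k m n} {g : Formal k p q} {x : Fin (m + p) → k}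
    {y : Fin (n + q) → k} :
    (f ⊕ᵗ g).Rel x y ↔ f.Rel (fun i => x (Fin.castAdd p i)) (fun i => y (Fin.castAdd q i)) ∧
      g.Rel (fun i => x (Fin.natAdd m i)) (fun i => y (Fin.natAdd n i)) :=
  mem_powTensor _ _ _ _

theorem rel_braid {x : Fin (m + n) → k} {y : Fin (n + m) → k} :
    (braid m n).Rel x y ↔ (∀ i, y (Fin.castAdd m i) = x (Fin.natAdd m i)) ∧
      ∀ i, y (Fin.natAdd n i) = x (Fin.castAdd n i) :=
  mem_powBraid _ _ _ _

theorem rel_add {x : Fin 2 → k} {y : Fin 1 → k} : add.Rel x y ↔ y 0 = x 0 + x 1 := Iff.rfl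

theorem rel_zero {x : Fin 0 → k} {y : Fin 1 → k} : zero.Rel x y ↔ y 0 = 0 := Iff.rfl

theorem rel_dup {x : Fin 1 → k} {y : Fin 2 → k} : dup.Rel x y ↔ y 0 = x 0 ∧ y 1 = x 0 := Iff.rfl

theorem rel_del {x : Fin 1 → k} {y : Fin 0 → k} : del.Rel x y ↔ True := Iff.rfl

theorem rel_smul {c : k} {x y : Fin 1 → k} : (smul c).Rel x y ↔ y 0 = c * x 0 := Iff.rfl

theorem rel_cup {x : Fin 2 → k} {y : Fin 0 → k} : cup.Rel x y ↔ x 0 = x 1 := Iff.rfl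

theorem rel_cap {x : Fin 0 → k} {y : Fin 2 → k} : cap.Rel x y ↔ y 0 = y 1 := Iff.rfl

end rel

theorem exists_vec_succ {k : Type u} {n : ℕ} {p : (Fin (n + 1) → k) → Prop} :
    (∃ x, p x) ↔ ∃ a v, p (Matrix.vecCons a v) :=
  Fin.exists_fin_succ_pi

/-- The defining relations hold for linear relations. -/
theorem ev_eq_of_relation {m n : ℕ} {f g : Formal k m n} (h : Relation f g) : f.ev = g.ev := by
  rw [ev_eq_iff]; intro x y
  cases h
  all_goals
    simp [rel_id, rel_comp, rel_tensor, rel_braid, rel_add, rel_zero, rel_dup, rel_del, rel_smul,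
      rel_cup, rel_cap, exists_vec_succ, coadd, codup, cozero, codel, cosmul,
      cup2, cap2, funext_iff, Fin.forall_fin_succ]
  case add_frobenius_left =>
    exact ⟨fun ⟨b, _, _⟩ => by grind, fun _ => ⟨y 0 - x 0, by grind, by grind⟩⟩
  case add_frobenius_right =>
    exact ⟨fun _ => ⟨x 0 - y 0, by grind, by grind⟩, fun ⟨b, _, _⟩ => by grind⟩
  case add_special =>
    exact ⟨fun ⟨a, b, _, _⟩ => by grind, fun _ => ⟨0, x 0, by grind, by grind⟩⟩
  all_goals grind

/-- Tuples are restrictions of sequences, whose indices are free of bounds. -/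
theorem exists_seq {n : ℕ} (x : Fin n → k) : ∃ X : ℕ → k, (fun i : Fin n => X i) = x :=
  ⟨fun i => if h : i < n then x ⟨i, h⟩ else 0, by simp⟩

/-- Moves do not change the linear relation that a formal morphism denotes. -/
theorem ev_eq_of_moves {m n : ℕ} {f g : Formal k m n} (h : Moves f g) : f.ev = g.ev := by
  induction h with
  | relation h => exact ev_eq_of_relation h
  | refl => rfl
  | symm _ h => exact h.symm
  | trans _ _ h h' => exact h.trans h'
  | comp_congr _ _ h h' => rw [ev, ev, h, h']
  | tensor_congr _ _ h h' => rw [ev, ev, h, h']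
  | id_comp => exact Category.id_comp _
  | comp_id => exact Category.comp_id _
  | assoc => exact Category.assoc _ _ _
  | tensor_id m n =>
    rw [ev_eq_iff]; intro x y
    simp only [rel_tensor, rel_id, funext_iff, Fin.forall_fin_add]
  | interchange f g f' g' =>
    rw [ev_eq_iff]; intro x z
    simp only [rel_tensor, rel_comp]
    constructor
    · rintro ⟨⟨y, h₁, h₂⟩, y', h₃, h₄⟩
      exact ⟨Fin.append y y', by simpa using ⟨h₁, h₃⟩, by simpa using ⟨h₂, h₄⟩⟩
    · rintro ⟨y, ⟨h₁, h₂⟩, h₃, h₄⟩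
      exact ⟨⟨_, h₁, h₃⟩, _, h₂, h₄⟩
  | tensor_assoc f g h =>
    rw [ev_eq_iff]; intro x y
    obtain ⟨x, rfl⟩ := exists_seq x
    obtain ⟨y, rfl⟩ := exists_seq y
    simp only [rel_tensor, rel_cast, and_assoc, Fin.val_cast, Fin.val_castAdd, Fin.val_natAdd,
      Nat.add_assoc]
  | unit_tensor f =>
    rw [ev_eq_iff]; intro x y
    obtain ⟨x, rfl⟩ := exists_seq x
    obtain ⟨y, rfl⟩ := exists_seq y
    simp [rel_tensor, rel_cast, rel_id, funext_iff]
  | tensor_unit f =>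
    rw [ev_eq_iff]; intro x y
    obtain ⟨x, rfl⟩ := exists_seq x
    obtain ⟨y, rfl⟩ := exists_seq y
    simp [rel_tensor, rel_cast, rel_id, funext_iff]
  | braid_natural f g =>
    rw [ev_eq_iff]; intro x y
    simp only [rel_tensor, rel_braid, rel_comp]
    constructor
    · rintro ⟨z, ⟨h₁, h₂⟩, h₃, h₄⟩
      refine ⟨Fin.append (fun i => x (Fin.natAdd _ i)) fun i => x (Fin.castAdd _ i), ?_⟩
      simp_all
    · rintro ⟨z, ⟨h₁, h₂⟩, h₃, h₄⟩
      refine ⟨Fin.append (fun i => y (Fin.natAdd _ i)) fun i => y (Fin.castAdd _ i), ?_⟩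
      simp_all
  | hexagon_forward m n p =>
    rw [ev_eq_iff]; intro x y
    obtain ⟨x, rfl⟩ := exists_seq x
    obtain ⟨y, rfl⟩ := exists_seq y
    simp only [rel_cast, rel_tensor, rel_braid, rel_comp, rel_id, funext_iff, Fin.forall_fin_add,
      Fin.val_cast, Fin.val_castAdd, Fin.val_natAdd, Nat.add_assoc]
    constructor
    · rintro ⟨⟨h₁, h₂⟩, h₃⟩
      refine ⟨fun i => if i < n then x (m + i) else if i < n + m then x (i - n) else x i, ?_⟩
      simp
      grind
    · rintro ⟨z, h⟩
      obtain ⟨z, rfl⟩ := exists_seq z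
      simp only [Fin.val_cast, Fin.val_castAdd, Fin.val_natAdd, Nat.add_assoc] at h
      obtain ⟨⟨⟨h₁, h₂⟩, h₃⟩, h₄, h₅, h₆⟩ := h
      exact ⟨⟨fun i => (h₄ i).trans (h₁ i), fun i => (h₅ i).trans (h₃ i)⟩,
        fun i => (h₆ i).trans (h₂ i)⟩
  | hexagon_reverse m n p =>
    rw [ev_eq_iff]; intro x y
    obtain ⟨x, rfl⟩ := exists_seq x
    obtain ⟨y, rfl⟩ := exists_seq y
    simp only [rel_cast, rel_tensor, rel_braid, rel_comp, rel_id, funext_iff, Fin.forall_fin_add,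
      Fin.val_cast, Fin.val_castAdd, Fin.val_natAdd, Nat.add_assoc]
    constructor
    · rintro ⟨h₁, h₂, h₃⟩
      refine ⟨fun i => if i < m then x i else if i < m + p then x (i + n) else x (i - p), ?_⟩
      simp
      grind
    · rintro ⟨z, h⟩
      obtain ⟨z, rfl⟩ := exists_seq z
      simp only [Fin.val_cast, Fin.val_castAdd, Fin.val_natAdd, Nat.add_assoc] at h
      obtain ⟨⟨h₁, h₂, h₃⟩, ⟨h₄, h₅⟩, h₆⟩ := h
      exact ⟨fun i => (h₄ i).trans (h₂ i), fun i => (h₅ i).trans (h₁ i),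
        fun i => (h₆ i).trans (h₃ i)⟩
  | braid_symm m n =>
    rw [ev_eq_iff]; intro x y
    simp only [rel_braid, rel_comp, rel_id, funext_iff, Fin.forall_fin_add]
    constructor
    · rintro ⟨z, h⟩
      simp_all
    · rintro h
      refine ⟨Fin.append (fun i => x (Fin.natAdd _ i)) fun i => x (Fin.castAdd _ i), ?_⟩
      simp_all

end Formal

/-! ### String diagrams on one wire -/

section wires

variable {C : Type u} [Category.{v} C] [MonoidalCategory C] {X : C}
  {add : X ⊗ X ⟶ X} {zero : 𝟙_ C ⟶ X} {dup : X ⟶ X ⊗ X} {del cozero cozero' : X ⟶ 𝟙_ C}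
  {cup : X ⊗ X ⟶ 𝟙_ C} {cap : 𝟙_ C ⟶ X ⊗ X} {codup : X ⊗ X ⟶ X}
  {neg : X ⟶ X} {codel : 𝟙_ C ⟶ X}

/-- If one leg of a cap ends in `e`, the other leg, bent by a cup, is `e`. -/
theorem cap_right_cup_right (e : X ⟶ 𝟙_ C)
    (zigzag : X ◁ cap ≫ (α_ _ _ _).inv ≫ cup ▷ X = (ρ_ _).hom ≫ (λ_ _).inv) :
    (ρ_ _).inv ≫ X ◁ (cap ≫ X ◁ e ≫ (ρ_ _).hom) ≫ cup = e := by
  calc _ = 𝟙 _ ⊗≫ X ◁ cap ⊗≫ ((X ⊗ X) ◁ e ≫ cup ▷ _) ⊗≫ 𝟙 _ := by monoidal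
    _ = 𝟙 _ ⊗≫ (X ◁ cap ≫ (α_ _ _ _).inv ≫ cup ▷ X) ⊗≫ e := by
        rw [whisker_exchange]; monoidal
    _ = _ := by rw [zigzag]; monoidal

theorem cap_left_cup_left (e : X ⟶ 𝟙_ C)
    (zigzag : cap ▷ X ≫ (α_ _ _ _).hom ≫ X ◁ cup = (λ_ _).hom ≫ (ρ_ _).inv) :
    (λ_ _).inv ≫ (cap ≫ e ▷ X ≫ (λ_ _).hom) ▷ X ≫ cup = e := by
  calc _ = 𝟙 _ ⊗≫ cap ▷ X ⊗≫ (e ▷ (X ⊗ X) ≫ _ ◁ cup) ⊗≫ 𝟙 _ := by monoidal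
    _ = 𝟙 _ ⊗≫ (cap ▷ X ≫ (α_ _ _ _).hom ≫ X ◁ cup) ⊗≫ e := by
        rw [← whisker_exchange]; monoidal
    _ = _ := by rw [zigzag]; monoidal

theorem cup_left_cap_left (s : 𝟙_ C ⟶ X)
    (zigzag : X ◁ cap ≫ (α_ _ _ _).inv ≫ cup ▷ X = (ρ_ _).hom ≫ (λ_ _).inv) :
    cap ≫ ((λ_ _).inv ≫ s ▷ X ≫ cup) ▷ X ≫ (λ_ _).hom = s := by
  calc _ = 𝟙 _ ⊗≫ (_ ◁ cap ≫ s ▷ (X ⊗ X)) ⊗≫ cup ▷ X ⊗≫ 𝟙 _ := by monoidal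
    _ = 𝟙 _ ⊗≫ s ⊗≫ (X ◁ cap ≫ (α_ _ _ _).inv ≫ cup ▷ X) ⊗≫ 𝟙 _ := by
        rw [whisker_exchange]; monoidal
    _ = _ := by rw [zigzag]; monoidal

theorem cup_right_cap_right (s : 𝟙_ C ⟶ X)
    (zigzag : cap ▷ X ≫ (α_ _ _ _).hom ≫ X ◁ cup = (λ_ _).hom ≫ (ρ_ _).inv) :
    cap ≫ X ◁ ((ρ_ _).inv ≫ X ◁ s ≫ cup) ≫ (ρ_ _).hom = s := by
  calc _ = 𝟙 _ ⊗≫ (cap ▷ _ ≫ (X ⊗ X) ◁ s) ⊗≫ X ◁ cup ⊗≫ 𝟙 _ := by monoidal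
    _ = 𝟙 _ ⊗≫ s ⊗≫ (cap ▷ X ≫ (α_ _ _ _).hom ≫ X ◁ cup) ⊗≫ 𝟙 _ := by
        rw [← whisker_exchange]; monoidal
    _ = _ := by rw [zigzag]; monoidal

/-- Codeletion is a unit for coduplication, since these are the transposes of deletion and of
duplication. The hypothesis `codup_eq` is the definition of coduplication, with the structure
isomorphisms that are identities in a strict category. -/
theorem codel_codup_of
    (codup_eq : (ρ_ _).inv ≫ (X ⊗ X) ◁ cap ≫ (α_ _ _ _).inv ≫ ((X ⊗ X) ◁ dup) ▷ X ≫
      ((α_ _ _ _).inv ≫ (α_ _ _ _).hom ▷ X) ▷ X ≫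
      (((X ◁ cup) ▷ X ≫ (ρ_ _).hom ▷ X ≫ cup) ▷ X) ≫ (λ_ _).hom = codup)
    (counit : dup ≫ del ▷ X = (λ_ X).inv)
    (zigzag : X ◁ cap ≫ (α_ _ _ _).inv ≫ cup ▷ X = (ρ_ _).hom ≫ (λ_ _).inv)
    (codel_cup : (λ_ _).inv ≫ codel ▷ X ≫ cup = del) :
    (ρ_ _).inv ≫ X ◁ codel ≫ codup = 𝟙 X := by
  rw [← codup_eq]
  calc _ = 𝟙 _ ⊗≫ X ◁ (codel ▷ 𝟙_ C ≫ X ◁ (cap ≫ dup ▷ X)) ⊗≫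
          X ◁ cup ▷ X ▷ X ⊗≫ cup ▷ X ⊗≫ 𝟙 _ := by monoidal
    _ = 𝟙 _ ⊗≫ X ◁ (cap ≫ dup ▷ X) ⊗≫ X ◁ ((λ_ _).inv ≫ codel ▷ X ≫ cup) ▷ X ▷ X ⊗≫
          cup ▷ X ⊗≫ 𝟙 _ := by rw [← whisker_exchange]; monoidal
    _ = 𝟙 _ ⊗≫ X ◁ cap ⊗≫ X ◁ (dup ≫ del ▷ X) ▷ X ⊗≫ cup ▷ X ⊗≫ 𝟙 _ := by
          rw [codel_cup]; monoidal
    _ = 𝟙 _ ⊗≫ (X ◁ cap ≫ (α_ _ _ _).inv ≫ cup ▷ X) ⊗≫ 𝟙 _ := by rw [counit]; monoidal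
    _ = 𝟙 X := by rw [zigzag]; monoidal

/-- If the common value of two wires is zero, then both wires are zero: the transpose of the
relation that duplicates a zero. -/
theorem codup_cozero_of
    (codup_eq : (ρ_ _).inv ≫ (X ⊗ X) ◁ cap ≫ (α_ _ _ _).inv ≫ ((X ⊗ X) ◁ dup) ▷ X ≫
      ((α_ _ _ _).inv ≫ (α_ _ _ _).hom ▷ X) ▷ X ≫
      (((X ◁ cup) ▷ X ≫ (ρ_ _).hom ▷ X ≫ cup) ▷ X) ≫ (λ_ _).hom = codup)
    (cap_cozero : cap ≫ X ◁ cozero ≫ (ρ_ _).hom = zero)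
    (zero_dup : zero ≫ dup = (λ_ _).inv ≫ (zero ⊗ₘ zero))
    (zero_cup : (ρ_ _).inv ≫ X ◁ zero ≫ cup = cozero') :
    codup ≫ cozero = (cozero' ⊗ₘ cozero') ≫ (λ_ _).hom := by
  rw [← codup_eq]
  calc _ = 𝟙 _ ⊗≫ (X ⊗ X) ◁ (cap ≫ dup ▷ X) ⊗≫
          ((X ◁ cup ▷ X ⊗≫ cup) ▷ X ≫ _ ◁ cozero) ⊗≫ 𝟙 _ := by monoidal
    _ = 𝟙 _ ⊗≫ (X ⊗ X) ◁ (cap ≫ (dup ▷ X ≫ (X ⊗ X) ◁ cozero)) ⊗≫ X ◁ cup ▷ X ⊗≫ cup ⊗≫ 𝟙 _ := by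
          rw [← whisker_exchange]; monoidal
    _ = 𝟙 _ ⊗≫ (X ⊗ X) ◁ ((cap ≫ X ◁ cozero ≫ (ρ_ _).hom) ≫ dup) ⊗≫
          X ◁ cup ▷ X ⊗≫ cup ⊗≫ 𝟙 _ := by
          rw [← whisker_exchange]; monoidal
    _ = 𝟙 _ ⊗≫ (X ⊗ X) ◁ zero ⊗≫ ((X ⊗ X ⊗ X) ◁ zero ≫ (X ◁ cup) ▷ X) ⊗≫ cup ⊗≫ 𝟙 _ := by
          rw [cap_cozero, zero_dup, MonoidalCategory.tensorHom_def]; monoidal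
    _ = 𝟙 _ ⊗≫ X ◁ ((ρ_ _).inv ≫ X ◁ zero ≫ cup) ⊗≫ ((ρ_ _).inv ≫ X ◁ zero ≫ cup) ⊗≫ 𝟙 _ := by
          rw [whisker_exchange]; monoidal
    _ = _ := by rw [zero_cup, MonoidalCategory.tensorHom_def']; monoidal

/-- If one copy of a value is zero, then the other copy is the state zero. The value is the common
value of itself and an arbitrary second one, whose copies are joined by a cap; by the Frobenius
relation the equation passes to both of them, and through the cap to the remaining copy. -/
theorem dup_cozero_of
    (frobenius : X ◁ dup ≫ (α_ _ _ _).inv ≫ codup ▷ X = codup ≫ dup)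
    (codel_codup : (ρ_ _).inv ≫ X ◁ codel ≫ codup = 𝟙 X)
    (codup_cozero : codup ≫ cozero = (cozero' ⊗ₘ cozero') ≫ (λ_ _).hom)
    (codel_dup : codel ≫ dup = cap)
    (cap_cozero' : cap ≫ cozero' ▷ X ≫ (λ_ _).hom = zero)
    (counit : dup ≫ X ◁ del = (ρ_ X).inv)
    (zero_del : zero ≫ del = 𝟙 (𝟙_ C)) :
    dup ≫ cozero ▷ X ≫ (λ_ _).hom = cozero ≫ zero := by
  have h : dup ≫ cozero ▷ X ≫ (λ_ _).hom = cozero' ≫ zero :=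
    calc _ = ((ρ_ _).inv ≫ X ◁ codel ≫ codup) ≫ dup ≫ cozero ▷ X ≫ (λ_ _).hom := by
            rw [codel_codup, Category.id_comp]
      _ = (ρ_ _).inv ≫ X ◁ codel ≫ (codup ≫ dup) ≫ cozero ▷ X ≫ (λ_ _).hom := by
            simp only [Category.assoc]
      _ = 𝟙 _ ⊗≫ X ◁ (codel ≫ dup) ⊗≫ (codup ≫ cozero) ▷ X ⊗≫ 𝟙 _ := by
            rw [← frobenius]; monoidal
      _ = 𝟙 _ ⊗≫ (X ◁ (cap ≫ cozero' ▷ X ≫ (λ_ _).hom) ≫ cozero' ▷ X) ⊗≫ 𝟙 _ := by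
            rw [codel_dup, codup_cozero, MonoidalCategory.tensorHom_def']; monoidal
      _ = cozero' ≫ zero := by rw [cap_cozero', whisker_exchange]; monoidal
  have h' : cozero = cozero' :=
    calc cozero = (ρ_ _).inv ≫ cozero ▷ _ ≫ (λ_ _).hom := by monoidal
      _ = dup ≫ (X ◁ del ≫ cozero ▷ _) ≫ (λ_ _).hom := by rw [← counit]; simp
      _ = (dup ≫ cozero ▷ X ≫ (λ_ _).hom) ≫ del := by rw [whisker_exchange]; simp
      _ = cozero' := by rw [h, Category.assoc, zero_del, Category.comp_id]
  rw [h, h']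

theorem codel_add_cozero_of (neg_cup : neg ▷ X ≫ cup = add ≫ cozero) (neg_del : neg ≫ del = del)
    (codel_cup : (ρ_ _).inv ≫ X ◁ codel ≫ cup = del) :
    (ρ_ _).inv ≫ X ◁ codel ≫ add ≫ cozero = del := by
  rw [← neg_cup, whisker_exchange_assoc, ← rightUnitor_inv_naturality_assoc, codel_cup, neg_del]

end wires

/-! ### Duplication and tensor products -/

section copy

variable {C : Type u} [Category.{v} C] [MonoidalCategory C] {A A' A'' B B' : C}

theorem tensorDel_assoc (e : A ⟶ 𝟙_ C) (e' : A' ⟶ 𝟙_ C) (e'' : A'' ⟶ 𝟙_ C) :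
    (α_ A A' A'').hom ≫ (e ⊗ₘ ((e' ⊗ₘ e'') ≫ (λ_ _).hom)) ≫ (λ_ _).hom =
      (((e ⊗ₘ e') ≫ (λ_ _).hom) ⊗ₘ e'') ≫ (λ_ _).hom := by
  simp only [MonoidalCategory.tensorHom_def]
  monoidal

variable [SymmetricCategory C]

/-- The duplication of a tensor product. -/
def tensorDup (d : A ⟶ A ⊗ A) (d' : B ⟶ B ⊗ B) : A ⊗ B ⟶ (A ⊗ B) ⊗ A ⊗ B :=
  (d ⊗ₘ d') ≫ tensorμ A A B B

theorem tensorDup_natural {dA : A ⟶ A ⊗ A} {dA' : A' ⟶ A' ⊗ A'} {dB : B ⟶ B ⊗ B}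
    {dB' : B' ⟶ B' ⊗ B'} {f : A ⟶ A'} {g : B ⟶ B'} (hf : f ≫ dA' = dA ≫ (f ⊗ₘ f))
    (hg : g ≫ dB' = dB ≫ (g ⊗ₘ g)) :
    (f ⊗ₘ g) ≫ tensorDup dA' dB' = tensorDup dA dB ≫ ((f ⊗ₘ g) ⊗ₘ f ⊗ₘ g) := by
  rw [tensorDup, tensorDup, Category.assoc, ← tensorμ_natural, tensorHom_comp_tensorHom_assoc,
    hf, hg, ← tensorHom_comp_tensorHom_assoc]

theorem tensorDup_assoc (d : A ⟶ A ⊗ A) (d' : A' ⟶ A' ⊗ A') (d'' : A'' ⟶ A'' ⊗ A'') :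
    (α_ A A' A'').hom ≫ tensorDup d (tensorDup d' d'') =
      tensorDup (tensorDup d d') d'' ≫ ((α_ _ _ _).hom ⊗ₘ (α_ _ _ _).hom) := by
  simp only [tensorDup, Category.assoc]
  rw [show ((d ⊗ₘ d') ≫ tensorμ A A A' A') ⊗ₘ d'' =
    ((d ⊗ₘ d') ⊗ₘ d'') ≫ tensorμ A A A' A' ▷ (A'' ⊗ A'') by
      rw [← tensorHom_id, tensorHom_comp_tensorHom, Category.comp_id],
    show d ⊗ₘ ((d' ⊗ₘ d'') ≫ tensorμ A' A' A'' A'') =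
    (d ⊗ₘ (d' ⊗ₘ d'')) ≫ (A ⊗ A) ◁ tensorμ A' A' A'' A'' by
      rw [← id_tensorHom, tensorHom_comp_tensorHom, Category.comp_id]]
  rw [Category.assoc, Category.assoc, tensor_associativity, associator_naturality_assoc]

theorem tensorDup_unit_right (d : A ⟶ A ⊗ A) :
    tensorDup d (λ_ (𝟙_ C)).inv ≫ ((ρ_ A).hom ⊗ₘ (ρ_ A).hom) = (ρ_ A).hom ≫ d := by
  rw [← rightUnitor_naturality, tensor_right_unitality, tensorDup,
    MonoidalCategory.tensorHom_def]
  simp only [Category.assoc]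

theorem tensorDup_unit_left (d : A ⟶ A ⊗ A) :
    tensorDup (λ_ (𝟙_ C)).inv d ≫ ((λ_ A).hom ⊗ₘ (λ_ A).hom) = (λ_ A).hom ≫ d := by
  rw [← leftUnitor_naturality, tensor_left_unitality, tensorDup,
    MonoidalCategory.tensorHom_def']
  simp only [Category.assoc]

/-- Duplication is a morphism of comonoids because it is cocommutative. -/
theorem dup_tensorDup {d : A ⟶ A ⊗ A} (coassoc : d ≫ A ◁ d = d ≫ d ▷ A ≫ (α_ _ _ _).hom)
    (cocomm : d ≫ (β_ A A).hom = d) : d ≫ tensorDup d d = d ≫ (d ⊗ₘ d) := by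
  have h : d ≫ (d ⊗ₘ d) = d ≫ A ◁ (d ≫ d ▷ A ≫ (α_ _ _ _).hom) ≫ (α_ _ _ _).inv := by
    calc _ = (d ≫ d ▷ A ≫ (α_ _ _ _).hom) ≫ (α_ _ _ _).inv ≫ (A ⊗ A) ◁ d := by
            simp [MonoidalCategory.tensorHom_def]
      _ = d ≫ A ◁ (d ≫ A ◁ d) ≫ (α_ _ _ _).inv := by rw [← coassoc]; simp
      _ = _ := by rw [coassoc]
  calc _ = (d ≫ (d ⊗ₘ d)) ≫ tensorμ A A A A := by rw [tensorDup, Category.assoc]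
    _ = d ≫ A ◁ (d ≫ (d ≫ (β_ A A).hom) ▷ A ≫ (α_ _ _ _).hom) ≫ (α_ _ _ _).inv := by
        rw [h]; simp [tensorμ]
    _ = _ := by rw [cocomm, h]

theorem tensorDup_counit_right {d : A ⟶ A ⊗ A} {e : A ⟶ 𝟙_ C} {d' : B ⟶ B ⊗ B} {e' : B ⟶ 𝟙_ C}
    (h : d ≫ A ◁ e = (ρ_ A).inv) (h' : d' ≫ B ◁ e' = (ρ_ B).inv) :
    tensorDup d d' ≫ (A ⊗ B) ◁ ((e ⊗ₘ e') ≫ (λ_ _).hom) = (ρ_ (A ⊗ B)).inv := by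
  have hn := tensorμ_natural (𝟙 A) e (𝟙 B) e'
  rw [id_tensorHom_id, id_tensorHom, id_tensorHom, id_tensorHom] at hn
  have hr := rightUnitor_monoidal A B
  rw [whiskerLeft_comp, tensorDup, Category.assoc, ← reassoc_of% hn,
    tensorHom_comp_tensorHom_assoc, h, h',
    ← cancel_mono (ρ_ (A ⊗ B)).hom]
  simp only [Category.assoc]
  rw [← hr]
  simp

/-- If deleting one copy with `c` forces the other copy to be the state `s`, then the same is true
for tensor products. -/
theorem tensorDup_counit_of {d : A ⟶ A ⊗ A} {c : A ⟶ 𝟙_ C} {s : 𝟙_ C ⟶ A} {d' : B ⟶ B ⊗ B}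
    {c' : B ⟶ 𝟙_ C} {s' : 𝟙_ C ⟶ B} (h : d ≫ c ▷ A ≫ (λ_ A).hom = c ≫ s)
    (h' : d' ≫ c' ▷ B ≫ (λ_ B).hom = c' ≫ s') :
    tensorDup d d' ≫ ((c ⊗ₘ c') ≫ (λ_ _).hom) ▷ (A ⊗ B) ≫ (λ_ (A ⊗ B)).hom =
      ((c ⊗ₘ c') ≫ (λ_ _).hom) ≫ (λ_ _).inv ≫ (s ⊗ₘ s') := by
  have hn := tensorμ_natural c (𝟙 A) c' (𝟙 B)
  rw [id_tensorHom_id, tensorHom_id, tensorHom_id, tensorHom_id] at hn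
  rw [comp_whiskerRight, tensorDup, Category.assoc, Category.assoc, ← reassoc_of% hn,
    ← leftUnitor_monoidal, tensorHom_comp_tensorHom, tensorHom_comp_tensorHom, h, h',
    Category.assoc, Iso.hom_inv_id_assoc, tensorHom_comp_tensorHom]

theorem tensorDup_braid {d : A ⟶ A ⊗ A} {d' : B ⟶ B ⊗ B} (h : d ≫ (β_ A A).hom = d)
    (h' : d' ≫ (β_ B B).hom = d') :
    tensorDup d d' ≫ (β_ (A ⊗ B) (A ⊗ B)).hom = tensorDup d d' := by
  rw [tensorDup, Category.assoc, SymmetricCategory.tensorμ_braid_swap,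
    tensorHom_comp_tensorHom_assoc, h, h']

theorem braid_tensorDup (d : A ⟶ A ⊗ A) (d' : B ⟶ B ⊗ B) :
    (β_ A B).hom ≫ tensorDup d' d = tensorDup d d' ≫ ((β_ A B).hom ⊗ₘ (β_ A B).hom) := by
  have : tensorμ A A B B ≫ ((β_ A B).hom ⊗ₘ (β_ A B).hom) =
      (β_ (A ⊗ A) (B ⊗ B)).hom ≫ tensorμ B B A A := by
    simp only [tensorμ, BraidedCategory.braiding_tensor_right_hom,
      BraidedCategory.braiding_tensor_left_hom]
    calc _ = 𝟙 _ ⊗≫ A ◁ (β_ A B).hom ▷ B ⊗≫ (β_ A B).hom ▷ A ▷ B ⊗≫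
          B ◁ A ◁ (β_ A B).hom ⊗≫ 𝟙 _ := by rw [MonoidalCategory.tensorHom_def]; monoidal
      _ = 𝟙 _ ⊗≫ A ◁ (β_ A B).hom ▷ B ⊗≫ (β_ A B).hom ▷ A ▷ B ⊗≫
          B ◁ A ◁ (β_ A B).hom ⊗≫ B ◁ ((β_ A B).hom ≫ (β_ B A).hom) ▷ A ⊗≫ 𝟙 _ := by
        rw [SymmetricCategory.symmetry]; monoidal
      _ = _ := by monoidal
  rw [tensorDup, tensorDup, Category.assoc, this, BraidedCategory.braiding_naturality_assoc]

/-- A pair of morphisms out of a tensor product is determined by its components. -/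
theorem tensorDup_proj {d : A ⟶ A ⊗ A} {e : A ⟶ 𝟙_ C} {d' : B ⟶ B ⊗ B} {e' : B ⟶ 𝟙_ C}
    (h : d ≫ A ◁ e = (ρ_ A).inv) (h' : d' ≫ e' ▷ B = (λ_ B).inv) :
    tensorDup d d' ≫ (A ◁ e' ⊗ₘ e ▷ B) ≫ ((ρ_ A).hom ⊗ₘ (λ_ B).hom) = 𝟙 _ := by
  have hn := tensorμ_natural (𝟙 A) e e' (𝟙 B)
  simp only [id_tensorHom, tensorHom_id] at hn
  rw [tensorDup, Category.assoc, ← reassoc_of% hn, tensorHom_comp_tensorHom_assoc, h, h', tensorμ,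
    braiding_tensorUnit_right]
  monoidal

/-- Discarding the second factor of the first copy of `A ⊗ B` leaves one copy of `B`. -/
theorem tensorDup_fst {d : A ⟶ A ⊗ A} {d' : B ⟶ B ⊗ B} {e' : B ⟶ 𝟙_ C}
    (h' : d' ≫ e' ▷ B = (λ_ B).inv) :
    tensorDup d d' ≫ (A ◁ e' ≫ (ρ_ A).hom) ▷ (A ⊗ B) = d ▷ B ≫ (α_ _ _ _).hom := by
  have hn := tensorμ_natural (𝟙 A) (𝟙 A) e' (𝟙 B)
  simp only [id_tensorHom, tensorHom_id, id_whiskerRight] at hn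
  rw [comp_whiskerRight, tensorDup, Category.assoc, ← reassoc_of% hn,
    MonoidalCategory.tensorHom_def, Category.assoc, ← whiskerLeft_comp_assoc, h', tensorμ,
    braiding_tensorUnit_right]
  monoidal

end copy

/-- A state can be moved past a duplication of the other factor. -/
theorem codel_fst {C : Type u} [Category.{v} C] [MonoidalCategory C] {A B : C} {codel : 𝟙_ C ⟶ B}
    {e : A ⟶ 𝟙_ C} {f : A ⊗ B ⟶ 𝟙_ C} (d : A ⟶ A ⊗ A) :
    (ρ_ A).inv ≫ A ◁ codel ≫ d ▷ B ≫ (α_ _ _ _).hom ≫ (e ⊗ₘ f) ≫ (λ_ _).hom =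
      d ≫ (e ⊗ₘ ((ρ_ A).inv ≫ A ◁ codel ≫ f)) ≫ (λ_ _).hom := by
  rw [whisker_exchange_assoc, ← rightUnitor_inv_naturality_assoc]
  simp only [MonoidalCategory.tensorHom_def']
  monoidal

/-! ### Bending wires -/

/-- Bending the last output of `f` to an input and back gives `f`. -/
theorem unbend_bend {C : Type u} [Category.{v} C] [MonoidalCategory C] {A B D : C}
    {cup : B ⊗ B ⟶ 𝟙_ C} {cap : 𝟙_ C ⟶ B ⊗ B}
    (zigzag : B ◁ cap ≫ (α_ _ _ _).inv ≫ cup ▷ B = (ρ_ _).hom ≫ (λ_ _).inv) (f : A ⟶ D ⊗ B) :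
    (ρ_ A).inv ≫ A ◁ cap ≫ (α_ _ _ _).inv ≫
      (f ▷ B ≫ (α_ _ _ _).hom ≫ D ◁ cup ≫ (ρ_ D).hom) ▷ B = f :=
  calc _ = (ρ_ A).inv ≫ (A ◁ cap ≫ f ▷ (B ⊗ B)) ≫ (α_ _ _ _).inv ≫
        ((α_ _ _ _).hom ≫ D ◁ cup ≫ (ρ_ D).hom) ▷ B := by monoidal
    _ = f ⊗≫ D ◁ (B ◁ cap ≫ (α_ _ _ _).inv ≫ cup ▷ B) ⊗≫ 𝟙 _ := by
        rw [whisker_exchange]; monoidal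
    _ = f := by rw [zigzag]; monoidal

/-! ### The relations in the syntactic category -/

namespace Syn

variable {k : Type u} [Field k]

/-- The generating object. -/
abbrev wire (k : Type u) : Syn k := ⟨1⟩

/-- Addition. -/
def add : wire k ⊗ wire k ⟶ wire k := cls Formal.add
/-- Zero. -/
def zero : 𝟙_ (Syn k) ⟶ wire k := cls Formal.zero
/-- Duplication. -/
def dup : wire k ⟶ wire k ⊗ wire k := cls Formal.dup
/-- Deletion. -/
def del : wire k ⟶ 𝟙_ (Syn k) := cls Formal.del
/-- Multiplication by the scalar `c`. -/
def smul (c : k) : wire k ⟶ wire k := cls (Formal.smul c)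
/-- Cup. -/
def cup : wire k ⊗ wire k ⟶ 𝟙_ (Syn k) := cls Formal.cup
/-- Cap. -/
def cap : 𝟙_ (Syn k) ⟶ wire k ⊗ wire k := cls Formal.cap
/-- Cozero. -/
def cozero : wire k ⟶ 𝟙_ (Syn k) := cls Formal.cozero
/-- Codeletion. -/
def codel : 𝟙_ (Syn k) ⟶ wire k := cls Formal.codel
/-- Coduplication. -/
def codup : wire k ⊗ wire k ⟶ wire k := cls Formal.codup

theorem cls_eq_of_relation {m n : ℕ} {f g : Formal k m n} (h : Formal.Relation f g) :
    cls f = cls g := cls_eq_cls_iff.2 (.relation h)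

theorem add_unit : (zero ▷ wire k) ≫ add = (λ_ (wire k)).hom := cls_eq_of_relation .add_unit

theorem add_assoc : (α_ _ _ _).hom ≫ (wire k ◁ add) ≫ add = (add ▷ wire k) ≫ add :=
  (Category.id_comp _).trans (cls_eq_of_relation .add_assoc)

theorem braid_add : (β_ (wire k) (wire k)).hom ≫ add = add := cls_eq_of_relation .add_comm

theorem dup_counit : dup ≫ (del ▷ wire k) = (λ_ (wire k)).inv := cls_eq_of_relation .dup_counit

theorem dup_coassoc : dup ≫ (wire k ◁ dup) = dup ≫ (dup ▷ wire k) ≫ (α_ _ _ _).hom :=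
  (cls_eq_of_relation .dup_coassoc).trans
    ((Category.comp_id (dup ≫ dup ▷ wire k)).symm.trans (Category.assoc _ _ _))

theorem dup_braid : dup ≫ (β_ (wire k) (wire k)).hom = dup := cls_eq_of_relation .dup_cocomm

theorem add_dup : add ≫ dup = ((dup : wire k ⟶ _) ⊗ₘ dup) ≫ tensorμ _ _ _ _ ≫ (add ⊗ₘ add) := by
  refine (cls_eq_of_relation .add_dup).trans (Eq.trans (b := (dup ⊗ₘ dup) ≫
    ((α_ _ _ _).inv ≫ (α_ _ _ _).hom ▷ wire k) ≫ (wire k ◁ (β_ (wire k) (wire k)).hom) ▷ wire k ≫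
      ((α_ _ _ _).inv ▷ wire k ≫ (α_ _ _ _).hom) ≫ (add ⊗ₘ add)) ?_ ?_)
  · have h1 : (α_ _ _ _).inv ≫ (α_ (wire k) (wire k) (wire k)).hom ▷ wire k = 𝟙 _ :=
      (Category.id_comp _).trans (id_whiskerRight _ _)
    have h2 : (α_ (wire k) (wire k) (wire k)).inv ▷ wire k ≫ (α_ _ _ _).hom = 𝟙 _ :=
      (Category.comp_id _).trans (id_whiskerRight _ _)
    rw [h1, h2]
    erw [Category.id_comp, Category.id_comp]
    exact Category.assoc (dup ⊗ₘ dup) ((wire k ◁ (β_ (wire k) (wire k)).hom) ▷ wire k)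
      (Z := wire k ⊗ wire k) (add ⊗ₘ add : (wire k ⊗ wire k) ⊗ wire k ⊗ wire k ⟶ _)
  · congr 1
    simp only [tensorμ, ← Category.assoc]
    congr 1
    monoidal

theorem codup_eq :
    (ρ_ _).inv ≫ (wire k ⊗ wire k) ◁ cap ≫ (α_ _ _ _).inv ≫ ((wire k ⊗ wire k) ◁ dup) ▷ wire k ≫
      ((α_ _ _ _).inv ≫ (α_ _ _ _).hom ▷ wire k) ▷ wire k ≫
      (((wire k ◁ cup) ▷ wire k ≫ (ρ_ _).hom ▷ wire k ≫ cup) ▷ wire k) ≫ (λ_ _).hom = codup := by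
  have h1 : ∀ f : (wire k ⊗ wire k) ⊗ 𝟙_ _ ⟶ wire k, (ρ_ _).inv ≫ f = f :=
    fun f => Category.id_comp f
  have h2 : ∀ f : ((wire k ⊗ wire k) ⊗ wire k) ⊗ wire k ⟶ wire k, (α_ _ _ _).inv ≫ f = f :=
    fun f => Category.id_comp f
  have h3 : ((α_ _ _ _).inv ≫ (α_ (wire k) (wire k) (wire k)).hom ▷ wire k) ▷ wire k = 𝟙 _ := by
    have : (α_ _ _ _).inv ≫ (α_ (wire k) (wire k) (wire k)).hom ▷ wire k = 𝟙 _ :=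
      (Category.id_comp _).trans (id_whiskerRight _ _)
    rw [this]; exact id_whiskerRight _ _
  have h4 : (ρ_ (wire k)).hom ▷ wire k ≫ cup = cup :=
    (congrArg (· ≫ cup) (id_whiskerRight (wire k) (wire k))).trans (Category.id_comp _)
  rw [h1, h2, h3, h4]
  erw [Category.id_comp, Category.comp_id]
  exact (Category.assoc ((wire k ⊗ wire k) ◁ cap) (((wire k ⊗ wire k) ◁ dup) ▷ wire k)
    (((wire k ◁ cup) ▷ wire k ≫ cup) ▷ wire k)).symm

theorem zero_dup : zero ≫ dup = (λ_ _).inv ≫ ((zero : 𝟙_ (Syn k) ⟶ _) ⊗ₘ zero) :=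
  (cls_eq_of_relation .zero_dup).trans (Category.id_comp _).symm

theorem add_del : add ≫ del = ((del : wire k ⟶ _) ⊗ₘ del) ≫ (λ_ _).hom :=
  (cls_eq_of_relation .add_del).trans (Category.comp_id _).symm

theorem zero_del : zero ≫ del = 𝟙 (𝟙_ (Syn k)) := cls_eq_of_relation .zero_del

theorem smul_mul (b c : k) : smul (b * c) = smul c ≫ smul b := cls_eq_of_relation (.smul_mul b c)

theorem smul_add (b c : k) : smul (b + c) = dup ≫ (smul b ⊗ₘ smul c) ≫ add :=
  (cls_eq_of_relation (.smul_add b c)).trans (Category.assoc dup (smul b ⊗ₘ smul c) add)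

theorem smul_one : smul (1 : k) = 𝟙 _ := cls_eq_of_relation .smul_one

theorem smul_zero : smul (0 : k) = del ≫ zero := cls_eq_of_relation .smul_zero

theorem add_smul (c : k) : (smul c ⊗ₘ smul c) ≫ add = add ≫ smul c :=
  cls_eq_of_relation (.add_smul c)

theorem zero_smul (c : k) : zero ≫ smul c = zero := cls_eq_of_relation (.zero_smul c)

theorem dup_smul (c : k) : dup ≫ (smul c ⊗ₘ smul c) = smul c ≫ dup :=
  cls_eq_of_relation (.dup_smul c)

theorem smul_del (c : k) : smul c ≫ del = del := cls_eq_of_relation (.del_smul c)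

theorem zigzag_left :
    wire k ◁ cap ≫ (α_ _ _ _).inv ≫ cup ▷ wire k = (ρ_ _).hom ≫ (λ_ _).inv := by
  have h : (α_ (wire k) (wire k) (wire k)).inv ≫ cup ▷ wire k = cup ▷ wire k :=
    Category.id_comp _
  rw [h]
  exact (cls_eq_of_relation .zigzag_left).trans (Category.id_comp (𝟙 (wire k))).symm

theorem zigzag_right :
    cap ▷ wire k ≫ (α_ _ _ _).hom ≫ wire k ◁ cup = (λ_ _).hom ≫ (ρ_ _).inv := by
  have h : (α_ (wire k) (wire k) (wire k)).hom ≫ wire k ◁ cup = wire k ◁ cup :=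
    Category.id_comp _
  rw [h]
  exact (cls_eq_of_relation .zigzag_right).trans (Category.id_comp (𝟙 (wire k))).symm

theorem dup_frobenius :
    wire k ◁ dup ≫ (α_ _ _ _).inv ≫ codup ▷ wire k = codup ≫ dup := by
  have h : (α_ (wire k) (wire k) (wire k)).inv ≫ codup ▷ wire k = codup ▷ wire k :=
    Category.id_comp _
  rw [h]
  exact cls_eq_of_relation .dup_frobenius_left

theorem zero_cozero : zero ≫ cozero = 𝟙 (𝟙_ (Syn k)) := cls_eq_of_relation .add_extra

theorem codel_del : codel ≫ del = 𝟙 (𝟙_ (Syn k)) := cls_eq_of_relation .dup_extra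

theorem neg_cup : smul (-1) ▷ wire k ≫ cup = add ≫ cozero := cls_eq_of_relation .cup_eq

theorem cap_eq : (cap : 𝟙_ (Syn k) ⟶ _) = codel ≫ dup := cls_eq_of_relation .cap_eq

theorem cozero_eq : (cozero : wire k ⟶ _) = (λ_ _).inv ≫ zero ▷ wire k ≫ cup :=
  (Category.id_comp (zero ▷ wire k ≫ cup)).symm

theorem codel_eq : (codel : _ ⟶ wire k) = cap ≫ del ▷ wire k ≫ (λ_ _).hom :=
  ((Category.comp_id (cap ≫ del ▷ wire k)).symm).trans (Category.assoc _ _ _)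

theorem cap_braid : cap ≫ (β_ (wire k) (wire k)).hom = cap := by
  rw [cap_eq, Category.assoc, dup_braid]

theorem codel_eq' : (codel : _ ⟶ wire k) = cap ≫ wire k ◁ del ≫ (ρ_ _).hom := by
  rw [codel_eq]
  conv_lhs => rw [← cap_braid]
  rw [Category.assoc, ← BraidedCategory.braiding_naturality_right_assoc, braiding_leftUnitor]

theorem dup_counit' : dup ≫ (wire k ◁ del) = (ρ_ (wire k)).inv := by
  rw [← cancel_mono (β_ (wire k) (𝟙_ _)).hom, Category.assoc,
    BraidedCategory.braiding_naturality_right, ← Category.assoc, dup_braid, dup_counit]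
  simp

/-- Existentially quantifying a summand leaves no constraint. -/
theorem codel_add_cozero :
    (ρ_ _).inv ≫ wire k ◁ codel ≫ add ≫ cozero = (del : wire k ⟶ _) :=
  codel_add_cozero_of neg_cup (smul_del _) (by
    rw [codel_eq']; exact cap_right_cup_right _ zigzag_left)

theorem cup_eq : (cup : wire k ⊗ wire k ⟶ _) = smul (-1) ▷ wire k ≫ add ≫ cozero := by
  rw [← neg_cup, ← comp_whiskerRight_assoc, ← smul_mul, neg_one_mul, neg_neg, smul_one,
    id_whiskerRight, Category.id_comp]

theorem codel_codup : (ρ_ _).inv ≫ wire k ◁ codel ≫ codup = 𝟙 (wire k) :=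
  codel_codup_of codup_eq dup_counit zigzag_left (by
    rw [codel_eq]; exact cap_left_cup_left _ zigzag_right)

theorem cap_cozero : cap ≫ wire k ◁ cozero ≫ (ρ_ _).hom = zero := by
  conv_lhs => rw [← cap_braid]
  rw [Category.assoc, ← BraidedCategory.braiding_naturality_left_assoc, braiding_rightUnitor,
    cozero_eq]
  exact cup_left_cap_left _ zigzag_left

/-- If `x = 0` then every copy of `x` is `0`. -/
theorem dup_cozero : dup ≫ cozero ▷ wire k ≫ (λ_ _).hom = cozero ≫ zero := by
  refine dup_cozero_of dup_frobenius codel_codup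
    (codup_cozero_of codup_eq cap_cozero zero_dup rfl) cap_eq.symm ?_ dup_counit' zero_del
  conv_lhs => rw [← cap_braid]
  rw [Category.assoc, ← BraidedCategory.braiding_naturality_right_assoc, braiding_leftUnitor]
  exact cup_right_cap_right _ zigzag_right

end Syn

/-! ### Evaluation on the syntactic category -/

namespace Syn

variable {k : Type u} [Field k]

/-- The linear relation denoted by a morphism of the syntactic category. -/
def ev {X Y : Syn k} : (X ⟶ Y) → (FinRel.pow k X.exponent ⟶ FinRel.pow k Y.exponent) :=
  Quotient.lift Formal.ev fun _ _ => Formal.ev_eq_of_moves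

/-- `Rel f x y`: the linear relation denoted by `f` relates `x` to `y`. -/
def Rel {X Y : Syn k} (f : X ⟶ Y) (x : Fin X.exponent → k) (y : Fin Y.exponent → k) : Prop :=
  (x, y) ∈ (ev f).rel

variable {X Y Z X' Y' : Syn k}

theorem ev_eq_iff {f g : X ⟶ Y} : ev f = ev g ↔ ∀ x y, Rel f x y ↔ Rel g x y :=
  ⟨fun h x y => by rw [Rel, h, Rel], fun h => FinRel.hom_ext h⟩

theorem ev_comp (f : X ⟶ Y) (g : Y ⟶ Z) : ev (f ≫ g) = ev f ≫ ev g := by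
  obtain ⟨f, rfl⟩ := cls_surjective f
  obtain ⟨g, rfl⟩ := cls_surjective g
  rfl

theorem rel_id {x y : Fin X.exponent → k} : Rel (𝟙 X) x y ↔ y = x := Iff.rfl

theorem rel_comp {f : X ⟶ Y} {g : Y ⟶ Z} {x : Fin X.exponent → k} {z : Fin Z.exponent → k} :
    Rel (f ≫ g) x z ↔ ∃ y, Rel f x y ∧ Rel g y z := by
  obtain ⟨f, rfl⟩ := cls_surjective f
  obtain ⟨g, rfl⟩ := cls_surjective g
  exact Formal.rel_comp

theorem rel_tensor {f : X ⟶ Y} {g : X' ⟶ Y'} {x : Fin (X.exponent + X'.exponent) → k}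
    {y : Fin (Y.exponent + Y'.exponent) → k} :
    Rel (f ⊗ₘ g) x y ↔
      Rel f (fun i => x (Fin.castAdd _ i)) (fun i => y (Fin.castAdd _ i)) ∧
        Rel g (fun i => x (Fin.natAdd _ i)) (fun i => y (Fin.natAdd _ i)) := by
  obtain ⟨f, rfl⟩ := cls_surjective f
  obtain ⟨g, rfl⟩ := cls_surjective g
  exact Formal.rel_tensor

theorem rel_braid {x : Fin (X.exponent + Y.exponent) → k}
    {y : Fin (Y.exponent + X.exponent) → k} :
    Rel (β_ X Y).hom x y ↔ (∀ i, y (Fin.castAdd _ i) = x (Fin.natAdd _ i)) ∧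
      ∀ i, y (Fin.natAdd _ i) = x (Fin.castAdd _ i) :=
  Formal.rel_braid

theorem rel_eqToHom (h : X = Y) {x : Fin X.exponent → k} {y : Fin Y.exponent → k} :
    Rel (eqToHom h) x y ↔ ∀ i, y i = x (Fin.cast (by rw [h]) i) := by
  subst h; exact funext_iff

/-! ### Linear morphisms -/

/-- The morphisms that are built without cups and caps. They denote graphs of linear maps. -/
inductive Lin : {X Y : Syn k} → (X ⟶ Y) → Prop
  | add : Lin (add : wire k ⊗ wire k ⟶ _)
  | zero : Lin (zero : _ ⟶ wire k)
  | dup : Lin (dup : wire k ⟶ _)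
  | del : Lin (del : wire k ⟶ _)
  | smul (c : k) : Lin (smul c)
  | id (X : Syn k) : Lin (𝟙 X)
  | comp {X Y Z : Syn k} {f : X ⟶ Y} {g : Y ⟶ Z} : Lin f → Lin g → Lin (f ≫ g)
  | tensor {X Y X' Y' : Syn k} {f : X ⟶ Y} {g : X' ⟶ Y'} : Lin f → Lin g → Lin (f ⊗ₘ g)
  | braid (X Y : Syn k) : Lin (β_ X Y).hom

theorem Lin.eqToHom (h : X = Y) : Lin (CategoryTheory.eqToHom h) := by
  subst h; exact .id X

theorem Lin.whiskerLeft (X : Syn k) {f : Y ⟶ Z} (hf : Lin f) : Lin (X ◁ f) :=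
  id_tensorHom X f ▸ .tensor (.id X) hf

theorem Lin.whiskerRight {f : Y ⟶ Z} (hf : Lin f) (X : Syn k) : Lin (f ▷ X) :=
  tensorHom_id f X ▸ .tensor hf (.id X)

theorem Lin.leftUnitor_hom (X : Syn k) : Lin (λ_ X).hom :=
  .eqToHom (congrArg Syn.mk (Nat.zero_add _))

theorem Lin.leftUnitor_inv (X : Syn k) : Lin (λ_ X).inv :=
  .eqToHom (congrArg Syn.mk (Nat.zero_add _)).symm

theorem Lin.rightUnitor_hom (X : Syn k) : Lin (ρ_ X).hom :=
  Lin.eqToHom (X := X ⊗ 𝟙_ _) (Y := X) (congrArg Syn.mk (Nat.add_zero X.exponent))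

theorem Lin.associator_hom (X Y Z : Syn k) : Lin (α_ X Y Z).hom :=
  .eqToHom (congrArg Syn.mk (Nat.add_assoc _ _ _))

theorem Lin.associator_inv (X Y Z : Syn k) : Lin (α_ X Y Z).inv :=
  .eqToHom (congrArg Syn.mk (Nat.add_assoc _ _ _)).symm

theorem Lin.tensorμ (X X' Y Y' : Syn k) : Lin (MonoidalCategory.tensorμ X X' Y Y') :=
  .comp (.associator_hom _ _ _) <| .comp (.whiskerLeft _ (.associator_inv _ _ _)) <|
    .comp (.whiskerLeft _ (.whiskerRight (.braid _ _) _)) <|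
    .comp (.whiskerLeft _ (.associator_hom _ _ _)) (.associator_inv _ _ _)

theorem Lin.exists_linearMap {f : X ⟶ Y} (hf : Lin f) :
    ∃ φ : (Fin X.exponent → k) →ₗ[k] (Fin Y.exponent → k), ∀ x y, Rel f x y ↔ y = φ x := by
  induction hf with
  | add =>
    refine ⟨LinearMap.pi fun _ => LinearMap.proj (R := k) (φ := fun _ : Fin 2 => k) 0 +
      LinearMap.proj 1, fun x y => ?_⟩
    exact Formal.rel_add.trans (by rw [funext_iff, Fin.forall_fin_one]; rfl)
  | zero =>
    refine ⟨0, fun x y => ?_⟩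
    exact Formal.rel_zero.trans (by rw [funext_iff, Fin.forall_fin_one]; rfl)
  | dup =>
    refine ⟨LinearMap.pi fun _ => LinearMap.proj (0 : Fin 1), fun x y => ?_⟩
    exact Formal.rel_dup.trans
      ((Fin.forall_fin_two (p := fun i => y i = x 0)).symm.trans funext_iff.symm)
  | del =>
    exact ⟨0, fun x y => iff_of_true trivial (funext fun i => i.elim0)⟩
  | smul c =>
    refine ⟨c • LinearMap.id, fun x y => ?_⟩
    exact Formal.rel_smul.trans (by rw [funext_iff, Fin.forall_fin_one]; rfl)
  | id X => exact ⟨LinearMap.id, fun x y => Iff.rfl⟩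
  | comp _ _ hf hg =>
    obtain ⟨φ, hφ⟩ := hf
    obtain ⟨ψ, hψ⟩ := hg
    exact ⟨ψ ∘ₗ φ, fun x y => by simp [rel_comp, hφ, hψ]⟩
  | @tensor X Y X' Y' f g _ _ hf hg =>
    obtain ⟨φ, hφ⟩ := hf
    obtain ⟨ψ, hψ⟩ := hg
    refine ⟨(FinRel.appendEquiv k Y.exponent Y'.exponent).toLinearMap ∘ₗ φ.prodMap ψ ∘ₗ
      (FinRel.appendEquiv k X.exponent X'.exponent).symm.toLinearMap, fun x y => ?_⟩
    refine rel_tensor.trans ((and_congr (hφ _ _) (hψ _ _)).trans ?_)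
    exact (Prod.ext_iff (x := (FinRel.appendEquiv k Y.exponent Y'.exponent).symm y)
      (y := (φ _, ψ _))).symm.trans (LinearEquiv.symm_apply_eq _)
  | braid X Y =>
    refine ⟨(FinRel.appendEquiv k _ _).toLinearMap ∘ₗ
      (LinearEquiv.prodComm k (Fin X.exponent → k) (Fin Y.exponent → k)).toLinearMap ∘ₗ
      (FinRel.appendEquiv k X.exponent Y.exponent).symm.toLinearMap, fun x y => ?_⟩
    refine rel_braid.trans ((and_congr funext_iff.symm funext_iff.symm).trans ?_)
    exact (Prod.ext_iff (x := (FinRel.appendEquiv k Y.exponent X.exponent).symm y)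
      (y := (_, _))).symm.trans (LinearEquiv.symm_apply_eq _)

/-! ### Linear functionals -/

/-- The linear functional with coefficients `a`, as a morphism. -/
def row : (n : ℕ) → (Fin n → k) → ((⟨n⟩ : Syn k) ⟶ wire k)
  | 0, _ => zero
  | n + 1, a => (row n (fun i => a i.castSucc) ⊗ₘ smul (a (Fin.last n))) ≫ add

theorem add_unit' : wire k ◁ zero ≫ add = (ρ_ (wire k)).hom := by
  rw [← braid_add, BraidedCategory.braiding_naturality_right_assoc, add_unit,
    braiding_leftUnitor]

theorem row_one (a : Fin 1 → k) : row 1 a = smul (a 0) := by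
  have h : ((zero : _ ⟶ wire k) ⊗ₘ smul (a 0)) ≫ add = (λ_ _).hom ≫ smul (a 0) := by
    rw [MonoidalCategory.tensorHom_def', Category.assoc, add_unit, leftUnitor_naturality]
  exact h.trans (Category.id_comp _)

theorem tensor_add_assoc (f : X ⟶ wire k) (g : Y ⟶ wire k) (h : Z ⟶ wire k) :
    (f ⊗ₘ ((g ⊗ₘ h) ≫ add)) ≫ add = (α_ _ _ _).inv ≫ (((f ⊗ₘ g) ≫ add) ⊗ₘ h) ≫ add := by
  have h₁ : f ⊗ₘ ((g ⊗ₘ h) ≫ add) = (f ⊗ₘ (g ⊗ₘ h)) ≫ wire k ◁ add := by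
    rw [← id_tensorHom, tensorHom_comp_tensorHom, Category.comp_id]
  have h₂ : ((f ⊗ₘ g) ≫ add) ⊗ₘ h = ((f ⊗ₘ g) ⊗ₘ h) ≫ add ▷ wire k := by
    rw [← tensorHom_id, tensorHom_comp_tensorHom, Category.comp_id]
  rw [h₁, h₂, Category.assoc, Category.assoc, ← add_assoc, associator_naturality_assoc,
    Iso.inv_hom_id_assoc]

theorem row_add (m n : ℕ) (a : Fin (m + n) → k) :
    row (m + n) a =
      (row m (fun i => a (Fin.castAdd n i)) ⊗ₘ row n (fun i => a (Fin.natAdd m i))) ≫ add := by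
  induction n with
  | zero =>
    change row m a = (row m a ⊗ₘ zero) ≫ add
    rw [MonoidalCategory.tensorHom_def, Category.assoc, add_unit', rightUnitor_naturality]
    exact (Category.id_comp _).symm
  | succ n ih =>
    refine Eq.trans ?_ (tensor_add_assoc _ _ _).symm
    refine Eq.trans ?_ (Category.id_comp _).symm
    exact congrArg (fun f => (f ⊗ₘ smul (a (Fin.last (m + n)))) ≫ add)
      (ih fun i => a i.castSucc)

theorem rel_row {n : ℕ} {a x : Fin n → k} {y : Fin 1 → k} :
    Rel (row n a) x y ↔ y 0 = ∑ i, a i * x i := by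
  induction n generalizing y with
  | zero => exact Formal.rel_zero.trans (by simp)
  | succ n ih =>
    refine rel_comp.trans ?_
    rw [Fin.sum_univ_castSucc]
    simp only [rel_tensor, ih]
    constructor
    · rintro ⟨z, ⟨h₁, h₂⟩, h₃⟩
      exact (Formal.rel_add.1 h₃).trans (congrArg₂ _ h₁ (Formal.rel_smul.1 h₂))
    · intro h
      exact ⟨![_, _], ⟨rfl, Formal.rel_smul.2 rfl⟩, Formal.rel_add.2 h⟩

/-- Linear morphisms pull linear functionals back to linear functionals. -/
theorem Lin.exists_comp_row {f : X ⟶ Y} (hf : Lin f) (a : Fin Y.exponent → k) :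
    ∃ b, f ≫ row Y.exponent a = row X.exponent b := by
  induction hf with
  | add =>
    refine ⟨fun _ => a 0, ?_⟩
    change Syn.add ≫ row 1 a = row (1 + 1) _
    rw [row_add, row_one, row_one, add_smul]
  | zero =>
    refine ⟨0, ?_⟩
    change Syn.zero ≫ row 1 a = Syn.zero
    rw [row_one, zero_smul]
  | dup =>
    refine ⟨fun _ => a 0 + a 1, ?_⟩
    change Syn.dup ≫ row (1 + 1) a = row 1 _
    rw [row_add, row_one, row_one, row_one, smul_add]
    rfl
  | del =>
    refine ⟨0, ?_⟩
    change Syn.del ≫ Syn.zero = row 1 _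
    rw [row_one, ← smul_zero]
    rfl
  | smul c =>
    refine ⟨fun _ => a 0 * c, ?_⟩
    change Syn.smul c ≫ row 1 a = row 1 _
    rw [row_one, row_one, smul_mul]
  | id X => exact ⟨a, Category.id_comp _⟩
  | comp _ _ hf hg =>
    obtain ⟨b, hb⟩ := hg a
    obtain ⟨c, hc⟩ := hf b
    exact ⟨c, by rw [Category.assoc, hb, hc]⟩
  | @tensor X Y X' Y' f g _ _ hf hg =>
    obtain ⟨b, hb⟩ := hf fun i => a (Fin.castAdd _ i)
    obtain ⟨c, hc⟩ := hg fun i => a (Fin.natAdd _ i)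
    refine ⟨Fin.append b c, ?_⟩
    refine (congrArg ((f ⊗ₘ g) ≫ ·) (row_add _ _ a)).trans (Eq.trans ?_ (row_add _ _ _).symm)
    simp only [Fin.append_left, Fin.append_right]
    rw [tensorHom_comp_tensorHom_assoc, hb, hc]
  | braid X Y =>
    refine ⟨Fin.append (fun i => a (Fin.natAdd _ i)) (fun i => a (Fin.castAdd _ i)), ?_⟩
    refine (congrArg ((β_ X Y).hom ≫ ·) (row_add _ _ a)).trans (Eq.trans ?_ (row_add _ _ _).symm)
    simp only [Fin.append_left, Fin.append_right]
    rw [← BraidedCategory.braiding_naturality_assoc, braid_add]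

/-- A linear morphism to the generating object is determined by its linear relation. -/
theorem Lin.ext_wire {f g : X ⟶ wire k} (hf : Lin f) (hg : Lin g)
    (h : ∀ x y, Rel f x y ↔ Rel g x y) : f = g := by
  obtain ⟨a, ha⟩ := hf.exists_comp_row fun _ => 1
  obtain ⟨b, hb⟩ := hg.exists_comp_row fun _ => 1
  have h1 : row (wire k).exponent (fun _ => (1 : k)) = 𝟙 (wire k) :=
    (row_one _).trans smul_one
  rw [h1, Category.comp_id] at ha hb
  subst ha hb
  congr 1
  funext i
  have := h (Pi.single i 1) fun _ => a i
  simp only [rel_row, Pi.single_apply] at this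
  simpa using this

/-! ### Duplication and deletion of several wires -/

/-- The duplication of `n` wires. -/
def dupPow : (n : ℕ) → ((⟨n⟩ : Syn k) ⟶ (⟨n⟩ : Syn k) ⊗ ⟨n⟩)
  | 0 => (λ_ (𝟙_ (Syn k))).inv
  | n + 1 => tensorDup (dupPow n) dup

/-- The deletion of `n` wires. -/
def delPow : (n : ℕ) → ((⟨n⟩ : Syn k) ⟶ 𝟙_ (Syn k))
  | 0 => 𝟙 _
  | n + 1 => (delPow n ⊗ₘ del) ≫ (λ_ _).hom

/-- The duplication of an object. -/
def copy (X : Syn k) : X ⟶ X ⊗ X := dupPow X.exponent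

/-- The deletion of an object. -/
def discard (X : Syn k) : X ⟶ 𝟙_ (Syn k) := delPow X.exponent

theorem copy_wire : copy (wire k) = dup := by
  have h := tensorDup_unit_left (dup : wire k ⟶ _)
  have h' : (λ_ (wire k)).hom ⊗ₘ (λ_ (wire k)).hom = 𝟙 _ := id_tensorHom_id _ _
  rw [h'] at h
  exact (Category.comp_id _).symm.trans (h.trans (Category.id_comp _))

theorem discard_wire : discard (wire k) = del := by
  have h : (𝟙 (𝟙_ (Syn k)) ⊗ₘ del) ≫ (λ_ _).hom = (λ_ (wire k)).hom ≫ del := by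
    rw [id_tensorHom, leftUnitor_naturality]
  exact h.trans (Category.id_comp _)

theorem dupPow_add (m n : ℕ) :
    (dupPow (m + n) : (⟨m + n⟩ : Syn k) ⟶ _) = tensorDup (dupPow m) (dupPow n) := by
  induction n with
  | zero =>
    have h := tensorDup_unit_right (dupPow m : (⟨m⟩ : Syn k) ⟶ _)
    have h' : (ρ_ (⟨m⟩ : Syn k)).hom ⊗ₘ (ρ_ (⟨m⟩ : Syn k)).hom = 𝟙 _ := id_tensorHom_id _ _
    rw [h'] at h
    exact ((Category.comp_id _).symm.trans (h.trans (Category.id_comp _))).symm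
  | succ n ih =>
    have h := tensorDup_assoc (dupPow m) (dupPow n) (dup : wire k ⟶ _)
    have h' : (α_ (⟨m⟩ : Syn k) ⟨n⟩ (wire k)).hom ⊗ₘ (α_ (⟨m⟩ : Syn k) ⟨n⟩ (wire k)).hom = 𝟙 _ :=
      id_tensorHom_id _ _
    rw [h', ← ih] at h
    exact (((Category.id_comp _).symm.trans h).trans (Category.comp_id _)).symm

theorem copy_tensor (X Y : Syn k) : copy (X ⊗ Y) = tensorDup (copy X) (copy Y) :=
  dupPow_add _ _

theorem delPow_add (m n : ℕ) :
    (delPow (m + n) : (⟨m + n⟩ : Syn k) ⟶ _) = (delPow m ⊗ₘ delPow n) ≫ (λ_ _).hom := by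
  induction n with
  | zero =>
    have h : ((delPow m : (⟨m⟩ : Syn k) ⟶ _) ⊗ₘ 𝟙 _) ≫ (λ_ _).hom = (ρ_ _).hom ≫ delPow m := by
      rw [tensorHom_id, unitors_equal, rightUnitor_naturality]
    exact (h.trans (Category.id_comp _)).symm
  | succ n ih =>
    have h := tensorDel_assoc (delPow m) (delPow n) (del : wire k ⟶ _)
    rw [← ih] at h
    exact ((Category.id_comp _).symm.trans h).symm

theorem discard_tensor (X Y : Syn k) :
    discard (X ⊗ Y) = (discard X ⊗ₘ discard Y) ≫ (λ_ _).hom :=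
  delPow_add _ _

theorem Lin.comp_copy {f : X ⟶ Y} (hf : Lin f) : f ≫ copy Y = copy X ≫ (f ⊗ₘ f) := by
  induction hf with
  | add => rw [copy_tensor, copy_wire, add_dup, tensorDup, Category.assoc]
  | zero => rw [copy_wire, zero_dup]; rfl
  | dup => rw [copy_tensor, copy_wire, dup_tensorDup dup_coassoc dup_braid]
  | del =>
    rw [copy_wire, MonoidalCategory.tensorHom_def, reassoc_of% dup_counit,
      ← leftUnitor_inv_naturality]
    rfl
  | smul c => rw [copy_wire, dup_smul]
  | id X => rw [id_tensorHom_id, Category.comp_id, Category.id_comp]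
  | comp _ _ hf hg => rw [Category.assoc, hg, reassoc_of% hf, tensorHom_comp_tensorHom]
  | tensor _ _ hf hg => rw [copy_tensor, copy_tensor, tensorDup_natural hf hg]
  | braid X Y => rw [copy_tensor, copy_tensor, braid_tensorDup]

theorem Lin.comp_discard {f : X ⟶ Y} (hf : Lin f) : f ≫ discard Y = discard X := by
  induction hf with
  | add => rw [discard_tensor, discard_wire, add_del]
  | zero => rw [discard_wire, zero_del]; rfl
  | dup =>
    rw [discard_tensor, discard_wire, MonoidalCategory.tensorHom_def, Category.assoc,
      reassoc_of% dup_counit, leftUnitor_naturality, Iso.inv_hom_id_assoc]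
  | del => rw [discard_wire]; exact Category.comp_id _
  | smul c => rw [discard_wire, smul_del]
  | id X => rw [Category.id_comp]
  | comp _ _ hf hg => rw [Category.assoc, hg, hf]
  | tensor _ _ hf hg =>
    rw [discard_tensor, discard_tensor, tensorHom_comp_tensorHom_assoc, hf, hg]
  | braid X Y =>
    rw [discard_tensor, discard_tensor, ← BraidedCategory.braiding_naturality_assoc,
      braiding_leftUnitor, unitors_equal]

theorem Lin.copy (X : Syn k) : Lin (copy X) := by
  obtain ⟨n⟩ := X
  induction n with
  | zero => exact .leftUnitor_inv _
  | succ n ih => exact .comp (.tensor ih .dup) (.tensorμ _ _ _ _)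

theorem Lin.discard (X : Syn k) : Lin (discard X) := by
  obtain ⟨n⟩ := X
  induction n with
  | zero => exact .id _
  | succ n ih => exact .comp (.tensor ih .del) (.leftUnitor_hom _)

theorem copy_braid (X : Syn k) : copy X ≫ (β_ X X).hom = copy X := by
  obtain ⟨n⟩ := X
  induction n with
  | zero =>
    change (λ_ (𝟙_ (Syn k))).inv ≫ (β_ (𝟙_ _) (𝟙_ _)).hom = (λ_ (𝟙_ (Syn k))).inv
    rw [leftUnitor_inv_braiding, unitors_inv_equal]
  | succ n ih => exact tensorDup_braid ih dup_braid

theorem copy_discard (X : Syn k) : copy X ≫ X ◁ discard X = (ρ_ X).inv := by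
  obtain ⟨n⟩ := X
  induction n with
  | zero =>
    change (λ_ (𝟙_ (Syn k))).inv ≫ 𝟙_ _ ◁ 𝟙 _ = (ρ_ (𝟙_ _)).inv
    rw [whiskerLeft_id, Category.comp_id, unitors_inv_equal]
  | succ n ih => exact tensorDup_counit_right ih dup_counit'

theorem copy_discard' (X : Syn k) : copy X ≫ discard X ▷ X = (λ_ X).inv := by
  rw [← copy_braid, Category.assoc, ← BraidedCategory.braiding_naturality_right,
    reassoc_of% copy_discard, rightUnitor_inv_braiding]

/-- The projection to the first factor. -/
def fst (X Y : Syn k) : X ⊗ Y ⟶ X := X ◁ discard Y ≫ (ρ_ X).hom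

/-- The projection to the second factor. -/
def snd (X Y : Syn k) : X ⊗ Y ⟶ Y := discard X ▷ Y ≫ (λ_ Y).hom

theorem Lin.fst (X Y : Syn k) : Lin (fst X Y) :=
  .comp (.whiskerLeft _ (.discard Y)) (.rightUnitor_hom X)

theorem Lin.snd (X Y : Syn k) : Lin (snd X Y) :=
  .comp (.whiskerRight (.discard X) _) (.leftUnitor_hom Y)

/-- The pair of two morphisms with the same source. -/
def pair (f : X ⟶ Y) (g : X ⟶ Z) : X ⟶ Y ⊗ Z := copy X ≫ (f ⊗ₘ g)

theorem Lin.pair {f : X ⟶ Y} {g : X ⟶ Z} (hf : Lin f) (hg : Lin g) : Lin (pair f g) :=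
  .comp (.copy X) (.tensor hf hg)

theorem pair_fst (f : X ⟶ Y) {g : X ⟶ Z} (hg : Lin g) : pair f g ≫ fst Y Z = f := by
  rw [pair, fst, Category.assoc, ← id_tensorHom, tensorHom_comp_tensorHom_assoc, hg.comp_discard,
    Category.comp_id, MonoidalCategory.tensorHom_def', Category.assoc,
    reassoc_of% copy_discard,
    rightUnitor_naturality, Iso.inv_hom_id_assoc]

theorem pair_snd {f : X ⟶ Y} (hf : Lin f) (g : X ⟶ Z) : pair f g ≫ snd Y Z = g := by
  rw [pair, snd, Category.assoc, ← tensorHom_id, tensorHom_comp_tensorHom_assoc, hf.comp_discard,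
    Category.comp_id, MonoidalCategory.tensorHom_def, Category.assoc,
    reassoc_of% copy_discard',
    leftUnitor_naturality, Iso.inv_hom_id_assoc]

theorem Lin.pair_fst_snd {f : X ⟶ Y ⊗ Z} (hf : Lin f) :
    Syn.pair (f ≫ Syn.fst Y Z) (f ≫ Syn.snd Y Z) = f := by
  have h := tensorDup_proj (copy_discard Y) (copy_discard' Z)
  rw [Syn.pair, ← tensorHom_comp_tensorHom, ← reassoc_of% hf.comp_copy, copy_tensor, Syn.fst,
    Syn.snd, ← tensorHom_comp_tensorHom, h, Category.comp_id]

theorem Lin.comp_pair {W : Syn k} {f : W ⟶ X} (hf : Lin f) (g : X ⟶ Y) (h : X ⟶ Z) :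
    f ≫ Syn.pair g h = Syn.pair (f ≫ g) (f ≫ h) := by
  rw [Syn.pair, Syn.pair, reassoc_of% hf.comp_copy, tensorHom_comp_tensorHom]

/-- A linear morphism is determined by its linear relation. -/
theorem Lin.ext {f g : X ⟶ Y} (hf : Lin f) (hg : Lin g) (h : ev f = ev g) : f = g := by
  obtain ⟨n⟩ := Y
  induction n with
  | zero =>
    have e : ∀ {f : X ⟶ ⟨0⟩}, Lin f → f = Syn.discard X := fun {f} hf =>
      (Category.comp_id f).symm.trans hf.comp_discard
    rw [e hf, e hg]
  | succ n ih =>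
    have h₁ := ih (hf.comp (.fst ⟨n⟩ (wire k))) (hg.comp (.fst ⟨n⟩ (wire k)))
      (by rw [ev_comp, ev_comp, h])
    have h₂ := Lin.ext_wire (hf.comp (.snd ⟨n⟩ (wire k))) (hg.comp (.snd ⟨n⟩ (wire k)))
      (ev_eq_iff.1 (by rw [ev_comp, ev_comp, h]))
    refine (Lin.pair_fst_snd (Y := ⟨n⟩) (Z := wire k) hf).symm.trans
      (Eq.trans ?_ (Lin.pair_fst_snd (Y := ⟨n⟩) (Z := wire k) hg))
    rw [h₁, h₂]

end Syn

/-! ### Realizing linear maps -/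

/-- A linear map factors through every linear map with smaller kernel. -/
theorem LinearMap.exists_eq_comp_of_ker_le {k U V W : Type*} [Field k] [AddCommGroup U]
    [AddCommGroup V] [AddCommGroup W] [Module k U] [Module k V] [Module k W] {φ : U →ₗ[k] V}
    {ψ : U →ₗ[k] W} (h : LinearMap.ker φ ≤ LinearMap.ker ψ) : ∃ χ : V →ₗ[k] W, ψ = χ ∘ₗ φ := by
  obtain ⟨χ, hχ⟩ := LinearMap.exists_extend
    ((LinearMap.ker φ).liftQ ψ h ∘ₗ φ.quotKerEquivRange.symm.toLinearMap)
  refine ⟨χ, LinearMap.ext fun x => ?_⟩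
  have := LinearMap.congr_fun hχ ⟨φ x, x, rfl⟩
  have e : φ.quotKerEquivRange.symm ⟨φ x, x, rfl⟩ = Submodule.Quotient.mk x :=
    (LinearEquiv.symm_apply_eq _).2 rfl
  simp only [LinearMap.comp_apply, LinearEquiv.coe_coe, e] at this
  exact this.symm

namespace Syn

variable {k : Type u} [Field k] {X Y Z X' Y' : Syn k}

theorem rel_discard {x : Fin X.exponent → k} {y : Fin 0 → k} : Rel (discard X) x y := by
  obtain ⟨φ, hφ⟩ := (Lin.discard X).exists_linearMap
  exact (hφ x y).2 (funext fun i => i.elim0)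

theorem rel_fst {x : Fin (X.exponent + Y.exponent) → k} {y : Fin X.exponent → k} :
    Rel (fst X Y) x y ↔ y = fun i => x (Fin.castAdd _ i) := by
  have h : fst X Y = 𝟙 X ⊗ₘ discard Y := by
    rw [id_tensorHom]; exact Category.comp_id _
  rw [h]
  exact rel_tensor.trans ((and_iff_left rel_discard).trans rel_id)

theorem rel_leftUnitor_hom {x : Fin (0 + X.exponent) → k} {y : Fin X.exponent → k} :
    Rel (λ_ X).hom x y ↔ ∀ i, y i = x (Fin.cast (Nat.zero_add _).symm i) :=
  rel_eqToHom (X := 𝟙_ _ ⊗ X) (Y := X) (congrArg Syn.mk (Nat.zero_add X.exponent))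

theorem rel_snd {x : Fin (X.exponent + Y.exponent) → k} {y : Fin Y.exponent → k} :
    Rel (snd X Y) x y ↔ y = fun i => x (Fin.natAdd _ i) := by
  rw [snd, rel_comp, ← tensorHom_id]
  constructor
  · rintro ⟨z, h, h'⟩
    have h₁ := (rel_tensor.1 h).2
    have h₂ := rel_leftUnitor_hom.1 h'
    funext i
    refine (h₂ i).trans ((congrArg z (Fin.ext ?_)).trans (congrFun h₁ i))
    exact (Nat.zero_add _).symm
  · rintro rfl
    refine ⟨fun i => x (Fin.natAdd _ (Fin.cast (Nat.zero_add _) i)), rel_tensor.2 ⟨rel_discard, ?_⟩,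
      rel_leftUnitor_hom.2 fun i => rfl⟩
    refine rel_id.2 (funext fun i => congrArg x (Fin.ext ?_))
    exact congrArg (X.exponent + ·) (Nat.zero_add _)

theorem Lin.row (n : ℕ) (a : Fin n → k) : Lin (row n a) := by
  induction n with
  | zero => exact .zero
  | succ n ih => exact .comp (.tensor (ih _) (.smul _)) .add

/-- Every linear map is denoted by a linear morphism. -/
theorem exists_lin (X Y : Syn k) (φ : (Fin X.exponent → k) →ₗ[k] (Fin Y.exponent → k)) :
    ∃ f : X ⟶ Y, Lin f ∧ ∀ x y, Rel f x y ↔ y = φ x := by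
  obtain ⟨n⟩ := Y
  induction n with
  | zero =>
    exact ⟨discard X, .discard X, fun x y => iff_of_true rel_discard (funext fun i => i.elim0)⟩
  | succ n ih =>
    obtain ⟨f, hf, hf'⟩ := ih (LinearMap.funLeft k k Fin.castSucc ∘ₗ φ)
    let g : X ⟶ wire k := row X.exponent fun i => φ (Pi.single i 1) (Fin.last n)
    have hg : Lin g := .row _ _
    have hl := hf.pair hg
    obtain ⟨ψ, hψ⟩ := hl.exists_linearMap
    refine ⟨pair f g, hl, fun x y => (hψ x y).trans ?_⟩
    have h : ψ x = φ x := by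
      have h₁ : Rel (pair f g ≫ fst ⟨n⟩ (wire k)) x fun i => ψ x (Fin.castSucc i) :=
        rel_comp.2 ⟨ψ x, (hψ x _).2 rfl, rel_fst.2 rfl⟩
      have h₂ : Rel (pair f g ≫ snd ⟨n⟩ (wire k)) x fun _ => ψ x (Fin.last n) :=
        rel_comp.2 ⟨ψ x, (hψ x _).2 rfl, rel_snd.2 (funext fun i => by
          rw [Subsingleton.elim i 0]; rfl)⟩
      rw [pair_fst _ hg, hf'] at h₁
      rw [pair_snd hf, rel_row] at h₂
      refine funext (Fin.lastCases ?_ fun i => ?_)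
      · refine h₂.trans ?_
        conv_rhs => rw [LinearMap.pi_apply_eq_sum_univ φ x]
        have e : ∀ i : Fin X.exponent, (Pi.single i (1 : k) : Fin X.exponent → k) =
            fun j => if i = j then 1 else 0 :=
          fun i => funext fun j => by simp [Pi.single_apply, eq_comm]
        simp [mul_comm, e]
      · exact congrFun h₁ i
    rw [h]

theorem Lin.ext_unit {f g : 𝟙_ (Syn k) ⟶ X} (hf : Lin f) (hg : Lin g) : f = g := by
  obtain ⟨φ, hφ⟩ := hf.exists_linearMap
  obtain ⟨ψ, hψ⟩ := hg.exists_linearMap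
  refine hf.ext hg (ev_eq_iff.2 fun x y => ?_)
  rw [hφ, hψ, show x = 0 from funext fun i => i.elim0, map_zero, map_zero]

/-! ### Systems of linear equations -/

/-- The effect that requires `n` wires to be zero. -/
def cozeroPow : (n : ℕ) → ((⟨n⟩ : Syn k) ⟶ 𝟙_ (Syn k))
  | 0 => 𝟙 _
  | n + 1 => (cozeroPow n ⊗ₘ cozero) ≫ (λ_ _).hom

/-- The state in which `n` wires are zero. -/
def zeroPow : (n : ℕ) → (𝟙_ (Syn k) ⟶ (⟨n⟩ : Syn k))
  | 0 => 𝟙 _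
  | n + 1 => (λ_ _).inv ≫ (zeroPow n ⊗ₘ zero)

/-- The effect that requires all wires to be zero. -/
def cozeros (X : Syn k) : X ⟶ 𝟙_ (Syn k) := cozeroPow X.exponent

/-- The state in which all wires are zero. -/
def zeros (X : Syn k) : 𝟙_ (Syn k) ⟶ X := zeroPow X.exponent

theorem cozeros_tensor_wire (X : Syn k) :
    cozeros (X ⊗ wire k) = (cozeros X ⊗ₘ cozero) ≫ (λ_ _).hom := rfl

theorem Lin.zeros (X : Syn k) : Lin (zeros X) := by
  obtain ⟨n⟩ := X
  induction n with
  | zero => exact .id _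
  | succ n ih => exact .comp (.leftUnitor_inv _) (.tensor ih .zero)

theorem zeros_cozeros (X : Syn k) : zeros X ≫ cozeros X = 𝟙 _ := by
  obtain ⟨n⟩ := X
  induction n with
  | zero => exact Category.id_comp _
  | succ n ih =>
    change ((λ_ _).inv ≫ (zeros ⟨n⟩ ⊗ₘ zero)) ≫ (cozeros ⟨n⟩ ⊗ₘ cozero) ≫ (λ_ _).hom = 𝟙 _
    rw [Category.assoc, tensorHom_comp_tensorHom_assoc, ih, zero_cozero, id_tensorHom_id,
      Category.id_comp, Iso.inv_hom_id]

theorem copy_cozeros (X : Syn k) :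
    copy X ≫ cozeros X ▷ X ≫ (λ_ X).hom = cozeros X ≫ zeros X := by
  obtain ⟨n⟩ := X
  induction n with
  | zero =>
    change (λ_ (𝟙_ (Syn k))).inv ≫ 𝟙 _ ▷ _ ≫ (λ_ (𝟙_ (Syn k))).hom = 𝟙 _ ≫ 𝟙 _
    rw [id_whiskerRight, Category.id_comp, Iso.inv_hom_id, Category.id_comp]
  | succ n ih => exact tensorDup_counit_of ih dup_cozero

theorem rel_cozero {x : Fin 1 → k} {y : Fin 0 → k} : Rel cozero x y ↔ x 0 = 0 := by
  change Formal.cozero.Rel x y ↔ _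
  simp [Formal.cozero, Formal.rel_id, Formal.rel_comp, Formal.rel_tensor, Formal.rel_zero,
    Formal.rel_cup, Formal.exists_vec_succ, funext_iff, Fin.forall_fin_succ, eq_comm]

theorem rel_cozeros {x : Fin X.exponent → k} {y : Fin 0 → k} : Rel (cozeros X) x y ↔ x = 0 := by
  obtain ⟨n⟩ := X
  induction n generalizing y with
  | zero => exact iff_of_true (rel_id.2 (funext fun i => i.elim0)) (funext fun i => i.elim0)
  | succ n ih =>
    have h : (cozeros ⟨n⟩ ⊗ₘ cozero) ≫ (λ_ (𝟙_ (Syn k))).hom = cozeros ⟨n⟩ ⊗ₘ cozero :=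
      Category.comp_id _
    refine (iff_of_eq (congrArg (Rel · x y) h)).trans (rel_tensor.trans ?_)
    refine (and_congr ih rel_cozero).trans ?_
    rw [funext_iff, funext_iff]
    exact (Fin.forall_fin_succ' (P := fun i => x i = 0)).symm

/-- The conjunction of two effects. -/
def conj (e e' : X ⟶ 𝟙_ (Syn k)) : X ⟶ 𝟙_ (Syn k) := pair e e' ≫ (λ_ _).hom

theorem conj_comm (e e' : X ⟶ 𝟙_ (Syn k)) : conj e e' = conj e' e := by
  rw [conj, pair, ← copy_braid, Category.assoc, Category.assoc,
    ← BraidedCategory.braiding_naturality_assoc, braiding_leftUnitor, ← unitors_equal, conj, pair,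
    Category.assoc]

/-- A system of linear equations implies its linear consequences. -/
theorem conj_cozeros {f : X ⟶ Y} (hf : Lin f) {g : Y ⟶ Z} (hg : Lin g) :
    conj (f ≫ cozeros Y) ((f ≫ g) ≫ cozeros Z) = f ≫ cozeros Y := by
  have h : conj (cozeros Y) (g ≫ cozeros Z) = cozeros Y := by
    rw [conj, pair, MonoidalCategory.tensorHom_def, Category.assoc, Category.assoc,
      leftUnitor_naturality, reassoc_of% copy_cozeros, ← Category.assoc (zeros Y),
      Lin.ext_unit (.comp (.zeros Y) hg) (.zeros Z), zeros_cozeros, Category.comp_id]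
  conv_rhs => rw [← h]
  rw [conj, conj, ← Category.assoc f, hf.comp_pair, Category.assoc]

theorem conj_eq_of_ker_le {f : X ⟶ Y} (hf : Lin f) {g : X ⟶ Z} (hg : Lin g)
    (h : ∀ x, Rel f x 0 → Rel g x 0) : conj (f ≫ cozeros Y) (g ≫ cozeros Z) = f ≫ cozeros Y := by
  obtain ⟨φ, hφ⟩ := hf.exists_linearMap
  obtain ⟨ψ, hψ⟩ := hg.exists_linearMap
  obtain ⟨χ, hχ⟩ := LinearMap.exists_eq_comp_of_ker_le (φ := φ) (ψ := ψ) fun x hx =>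
    ((hψ x 0).1 (h x ((hφ x 0).2 hx.symm))).symm
  obtain ⟨c, hc, hc'⟩ := exists_lin Y Z χ
  have e : g = f ≫ c := hg.ext (hf.comp hc) (ev_eq_iff.2 fun x z => by
    simp [rel_comp, hψ, hc', hφ, hχ])
  rw [e, conj_cozeros hf hc]

/-- Systems of linear equations with the same solutions are equal as effects. -/
theorem comp_cozeros_eq {f : X ⟶ Y} (hf : Lin f) {g : X ⟶ Z} (hg : Lin g)
    (h : ∀ x, Rel f x 0 ↔ Rel g x 0) : f ≫ cozeros Y = g ≫ cozeros Z := by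
  rw [← conj_eq_of_ker_le hf hg fun x => (h x).1, conj_comm,
    conj_eq_of_ker_le hg hf fun x => (h x).2]

/-! ### Elimination of variables -/

theorem conj_fst (e : X ⟶ 𝟙_ (Syn k)) (e' : X ⊗ Y ⟶ 𝟙_ (Syn k)) :
    conj (fst X Y ≫ e) e' = copy X ▷ Y ≫ (α_ _ _ _).hom ≫ (e ⊗ₘ e') ≫ (λ_ _).hom := by
  have h : (fst X Y ≫ e) ⊗ₘ e' = fst X Y ▷ (X ⊗ Y) ≫ (e ⊗ₘ e') := by
    rw [← tensorHom_id, tensorHom_comp_tensorHom, Category.id_comp]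
  rw [conj, pair, copy_tensor, h, Category.assoc, Category.assoc, fst,
    reassoc_of% tensorDup_fst (copy_discard' Y)]

theorem conj_discard (e : X ⟶ 𝟙_ (Syn k)) : conj e (discard X) = e := by
  rw [conj, pair, MonoidalCategory.tensorHom_def', Category.assoc, Category.assoc,
    reassoc_of% copy_discard, unitors_equal, rightUnitor_naturality, Iso.inv_hom_id_assoc]

theorem conj_cozero (f : X ⟶ Y) (g : X ⟶ wire k) :
    conj (f ≫ cozeros Y) (g ≫ cozero) = pair f g ≫ cozeros (Y ⊗ wire k) := by
  rw [conj, pair, pair, ← tensorHom_comp_tensorHom, Category.assoc, Category.assoc, Category.assoc]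
  rfl

theorem rel_copy {x : Fin X.exponent → k} {y : Fin (X.exponent + X.exponent) → k} :
    Rel (copy X) x y ↔
      (fun i => y (Fin.castAdd _ i)) = x ∧ (fun i => y (Fin.natAdd _ i)) = x := by
  obtain ⟨φ, hφ⟩ := (Lin.copy X).exists_linearMap
  have h : pair (𝟙 X) (𝟙 X) = copy X := by rw [pair, id_tensorHom_id, Category.comp_id]
  have h₁ : Rel (copy X ≫ fst X X) x fun i => φ x (Fin.castAdd _ i) :=
    rel_comp.2 ⟨φ x, (hφ x _).2 rfl, rel_fst.2 rfl⟩
  have h₂ : Rel (copy X ≫ snd X X) x fun i => φ x (Fin.natAdd _ i) :=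
    rel_comp.2 ⟨φ x, (hφ x _).2 rfl, rel_snd.2 rfl⟩
  rw [← h, pair_fst _ (.id X), rel_id] at h₁
  rw [← h, pair_snd (.id X), rel_id] at h₂
  rw [hφ, funext_iff, Fin.forall_fin_add, ← funext_iff, ← funext_iff, h₁, h₂]

theorem rel_pair {f : X ⟶ Y} {g : X ⟶ Z} {x : Fin X.exponent → k}
    {y : Fin (Y.exponent + Z.exponent) → k} :
    Rel (pair f g) x y ↔
      Rel f x (fun i => y (Fin.castAdd _ i)) ∧ Rel g x (fun i => y (Fin.natAdd _ i)) := by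
  refine rel_comp.trans ⟨?_, fun h => ⟨Fin.append x x, rel_copy.2 ?_, rel_tensor.2 ?_⟩⟩
  · rintro ⟨z, h, h'⟩
    obtain ⟨h₁, h₂⟩ := rel_copy.1 h
    have h₃ := rel_tensor.1 h'
    rwa [h₁, h₂] at h₃
  · simp only [Fin.append_left, Fin.append_right, and_self]
  · simpa only [Fin.append_left, Fin.append_right] using h

theorem Lin.rightUnitor_inv (X : Syn k) : Lin (ρ_ X).inv :=
  Lin.eqToHom (X := X) (Y := X ⊗ 𝟙_ _) (congrArg Syn.mk (Nat.add_zero X.exponent)).symm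

/-- The effects that are given by a system of linear equations. -/
def IsSystem (e : X ⟶ 𝟙_ (Syn k)) : Prop := ∃ (Y : Syn k) (f : X ⟶ Y), Lin f ∧ e = f ≫ cozeros Y

theorem IsSystem.comp {e : Y ⟶ 𝟙_ (Syn k)} (he : IsSystem e) {f : X ⟶ Y} (hf : Lin f) :
    IsSystem (f ≫ e) := by
  obtain ⟨Z, g, hg, rfl⟩ := he
  exact ⟨Z, f ≫ g, hf.comp hg, (Category.assoc _ _ _).symm⟩

theorem codel_fst_wire : (ρ_ X).inv ≫ X ◁ codel ≫ fst X (wire k) = 𝟙 X := by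
  rw [fst, discard_wire, ← whiskerLeft_comp_assoc, codel_del, whiskerLeft_id, Category.id_comp,
    Iso.inv_hom_id]

/-- An equation `a x + y = 0` can be dropped together with the quantified variable `y`, if `y` does
not occur in the other equations. -/
theorem codel_eliminate {f : X ⟶ Y} {a : X ⟶ wire k} (ha : Lin a) :
    (ρ_ X).inv ≫ X ◁ codel ≫ conj (fst X (wire k) ≫ f ≫ cozeros Y) ((a ▷ wire k ≫ add) ≫ cozero) =
      f ≫ cozeros Y := by
  have h : (ρ_ X).inv ≫ X ◁ codel ≫ (a ▷ wire k ≫ add) ≫ cozero = discard X := by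
    rw [Category.assoc, whisker_exchange_assoc, ← rightUnitor_inv_naturality_assoc,
      codel_add_cozero, ← discard_wire, ha.comp_discard]
  rw [conj_fst, codel_fst, h]
  have := conj_discard (f ≫ cozeros Y)
  rwa [conj, pair, Category.assoc] at this

/-- A quantified variable can be eliminated from a system of linear equations. -/
theorem IsSystem.codel {e : X ⊗ wire k ⟶ 𝟙_ (Syn k)} (he : IsSystem e) :
    IsSystem ((ρ_ X).inv ≫ X ◁ codel ≫ e) := by
  obtain ⟨Y, f, hf, rfl⟩ := he
  obtain ⟨φ, hφ⟩ := hf.exists_linearMap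
  let ι : (Fin X.exponent → k) →ₗ[k] (Fin (X ⊗ wire k).exponent → k) :=
    (FinRel.appendEquiv k X.exponent 1).toLinearMap ∘ₗ LinearMap.inl k _ _
  let w : Fin (X ⊗ wire k).exponent → k := FinRel.appendEquiv k X.exponent 1 (0, 1)
  have hι : ∀ z : Fin (X ⊗ wire k).exponent → k,
      z = ι (fun i => z (Fin.castAdd 1 i)) + z (Fin.natAdd X.exponent 0) • w := by
    intro z
    refine (FinRel.appendEquiv k X.exponent 1).symm.injective ?_
    rw [map_add, map_smul]
    refine Prod.ext (funext fun i => ?_) (funext fun i => ?_)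
    · simp [ι, w, FinRel.appendEquiv]
    · rw [Subsingleton.elim i 0]
      simp [ι, w, FinRel.appendEquiv]
  -- `w` is the vector of coefficients of the last variable.
  by_cases hw : φ w = 0
  · obtain ⟨g, hg, hg'⟩ := exists_lin X Y (φ ∘ₗ ι)
    have e : f = fst X (wire k) ≫ g := hf.ext (.comp (.fst _ _) hg) (ev_eq_iff.2 fun z y => by
      have h : φ z = φ (ι fun i => z (Fin.castAdd 1 i)) := by
        conv_lhs => rw [hι z, map_add, map_smul, hw, _root_.smul_zero, add_zero]
      rw [hφ, rel_comp, h]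
      simp [rel_fst, hg'])
    refine ⟨Y, g, hg, ?_⟩
    rw [e, Category.assoc, reassoc_of% codel_fst_wire]
  · -- The `i`-th equation is solved for the last variable, `t = -α x`, and this is substituted into
    -- the others.
    obtain ⟨i, hi⟩ := Function.ne_iff.1 hw
    let α : (Fin X.exponent → k) →ₗ[k] k := (φ w i)⁻¹ • (LinearMap.proj i ∘ₗ φ ∘ₗ ι)
    obtain ⟨a, ha, ha'⟩ := exists_lin X (wire k) (LinearMap.pi fun _ => α)
    obtain ⟨g, hg, hg'⟩ := exists_lin X Y (φ ∘ₗ ι - α.smulRight (φ w))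
    have hl : Lin (a ▷ wire k ≫ Syn.add) := .comp (.whiskerRight ha _) .add
    refine ⟨Y, g, hg, ?_⟩
    rw [← codel_eliminate ha, ← Category.assoc (fst _ _), conj_cozero]
    congr 2
    refine comp_cozeros_eq hf (.pair (.comp (.fst _ _) hg) hl) fun z => ?_
    have h₁ : Rel (fst X (wire k) ≫ g) z 0 ↔
        φ (ι fun i => z (Fin.castAdd 1 i)) = α (fun i => z (Fin.castAdd 1 i)) • φ w := by
      rw [rel_comp]
      simp [rel_fst, hg', eq_comm (a := (0 : Fin Y.exponent → k)), sub_eq_zero]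
    have h₂ : Rel (a ▷ wire k ≫ Syn.add) z 0 ↔
        α (fun i => z (Fin.castAdd 1 i)) + z (Fin.natAdd X.exponent 0) = 0 := by
      rw [← tensorHom_id, rel_comp]
      constructor
      · rintro ⟨y, h, h'⟩
        obtain ⟨h₃, h₄⟩ := rel_tensor.1 h
        exact (congrArg₂ (· + ·) (congrFun ((ha' _ _).1 h₃) 0)
          (congrFun (rel_id.1 h₄) 0)).symm.trans (Formal.rel_add.1 h').symm
      · intro h
        refine ⟨Fin.append (fun _ => α fun i => z (Fin.castAdd 1 i))
          (fun i => z (Fin.natAdd X.exponent i)), rel_tensor.2 ?_, Formal.rel_add.2 h.symm⟩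
        simp only [Fin.append_left, Fin.append_right]
        exact ⟨(ha' _ _).2 rfl, rel_id.2 rfl⟩
    refine (hφ z 0).trans (Iff.trans ?_ (rel_pair.trans (and_congr h₁ h₂)).symm)
    have h₃ : φ z = _ := (congrArg φ (hι z)).trans ((map_add _ _ _).trans
      (congrArg _ (map_smul φ _ _)))
    rw [eq_comm, h₃]
    constructor
    · intro h
      have h₄ : α (fun i => z (Fin.castAdd 1 i)) + z (Fin.natAdd X.exponent 0) = 0 := by
        have := congrFun h i
        simp only [Pi.add_apply, Pi.smul_apply, Pi.zero_apply, smul_eq_mul] at this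
        simp only [α, LinearMap.smul_apply, LinearMap.comp_apply, LinearMap.proj_apply,
          smul_eq_mul]
        have hi' : φ w i ≠ 0 := hi
        rw [← mul_right_inj' hi', mul_add, mul_inv_cancel_left₀ hi', mul_zero,
          mul_comm (φ w i) (z _)]
        exact this
      rw [eq_neg_of_add_eq_zero_left h₄, neg_smul]
      exact ⟨eq_neg_of_add_eq_zero_left h, neg_add_cancel _⟩
    · rintro ⟨h, h'⟩
      rw [h, ← _root_.add_smul, h', _root_.zero_smul]

/-! ### Effects -/

/-- A cup adds the equation `-x + y = 0`. -/
theorem IsSystem.comp_cup {e : X ⊗ 𝟙_ (Syn k) ⟶ 𝟙_ (Syn k)} (he : IsSystem e) :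
    IsSystem (X ◁ cup ≫ e) := by
  rw [cup_eq, whiskerLeft_comp, whiskerLeft_comp, Category.assoc, Category.assoc]
  refine .comp (.comp ?_ (.whiskerLeft _ .add)) (.whiskerLeft _ (.whiskerRight (.smul _) _))
  obtain ⟨Y, f, hf, rfl⟩ := he
  refine ⟨Y ⊗ wire k, ((ρ_ X).inv ≫ f) ▷ wire k,
    .whiskerRight (.comp (.rightUnitor_inv X) hf) _, ?_⟩
  rw [cozeros_tensor_wire, MonoidalCategory.tensorHom_def', Category.assoc,
    ← whisker_exchange_assoc, unitors_equal, rightUnitor_naturality,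
    rightUnitor_naturality_assoc, Category.assoc, Iso.hom_inv_id_assoc]

/-- A cap identifies two variables and quantifies over their common value. -/
theorem IsSystem.comp_cap {e : X ⊗ wire k ⊗ wire k ⟶ 𝟙_ (Syn k)} (he : IsSystem e) :
    IsSystem (X ◁ cap ≫ e) := by
  have h := ((he.comp (.whiskerLeft X .dup)).codel).comp (.rightUnitor_hom X)
  rwa [Iso.hom_inv_id_assoc, ← whiskerLeft_comp_assoc, ← cap_eq] at h

/-- Precomposition with any morphism, on the last wires, turns systems of equations into such
systems. -/
theorem IsSystem.comp_whiskerLeft {f : X ⟶ Y} {Q : Syn k} {e : Q ⊗ Y ⟶ 𝟙_ (Syn k)}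
    (he : IsSystem e) : IsSystem (Q ◁ f ≫ e) := by
  obtain ⟨f, rfl⟩ := cls_surjective f
  obtain ⟨m⟩ := X
  obtain ⟨n⟩ := Y
  change Formal k m n at f
  induction f generalizing Q with
  | gen g =>
    cases g with
    | add => exact he.comp (.whiskerLeft _ .add)
    | zero => exact he.comp (.whiskerLeft _ .zero)
    | dup => exact he.comp (.whiskerLeft _ .dup)
    | del => exact he.comp (.whiskerLeft _ .del)
    | smul c => exact he.comp (.whiskerLeft _ (.smul c))
    | cup => exact he.comp_cup
    | cap => exact he.comp_cap
  | id n => exact he.comp (.whiskerLeft _ (.id _))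
  | comp f g hf hg =>
    rw [cls_comp, whiskerLeft_comp, Category.assoc]
    exact hf (hg he)
  | @tensor m n p q f g hf hg =>
    rw [cls_tensor, MonoidalCategory.tensorHom_def, whiskerLeft_comp, Category.assoc]
    have h₁ : cls f ▷ (⟨p⟩ : Syn k) = (β_ _ _).hom ≫ (⟨p⟩ : Syn k) ◁ cls f ≫ (β_ _ _).hom := by
      rw [BraidedCategory.braiding_naturality_right, SymmetricCategory.symmetry_assoc]
    have h₂ : ∀ {A B R : Syn k} {h : B ⟶ R} {e : Q ⊗ A ⊗ R ⟶ 𝟙_ (Syn k)},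
        (∀ {Q : Syn k} {e : Q ⊗ R ⟶ 𝟙_ (Syn k)}, IsSystem e → IsSystem (Q ◁ h ≫ e)) →
        IsSystem e → IsSystem (Q ◁ A ◁ h ≫ e) := by
      intro A B R h e hh he
      have := (hh (he.comp (.associator_hom Q A R))).comp (.associator_inv Q A B)
      rwa [associator_naturality_right_assoc, Iso.inv_hom_id_assoc] at this
    rw [h₁, whiskerLeft_comp, whiskerLeft_comp, Category.assoc, Category.assoc]
    exact (h₂ hf ((h₂ hg he).comp (.whiskerLeft _ (.braid _ _)))).comp (.whiskerLeft _ (.braid _ _))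
  | braid m n => exact he.comp (.whiskerLeft _ (.braid ⟨m⟩ ⟨n⟩))

/-- Every effect is given by a system of linear equations. -/
theorem isSystem (e : X ⟶ 𝟙_ (Syn k)) : IsSystem e := by
  have h : IsSystem (λ_ (𝟙_ (Syn k))).hom :=
    ⟨𝟙_ _, (λ_ _).hom, .leftUnitor_hom _, (Category.comp_id _).symm⟩
  have h' := (h.comp_whiskerLeft (f := e)).comp (.leftUnitor_inv X)
  rwa [leftUnitor_naturality, Iso.inv_hom_id_assoc] at h'

/-- An effect is determined by its linear relation. -/
theorem effect_ext {e e' : X ⟶ 𝟙_ (Syn k)} (h : ev e = ev e') : e = e' := by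
  obtain ⟨Y, f, hf, rfl⟩ := isSystem e
  obtain ⟨Z, g, hg, rfl⟩ := isSystem e'
  refine comp_cozeros_eq hf hg fun x => ?_
  have := ev_eq_iff.1 h x 0
  simpa [rel_comp, rel_cozeros] using this

/-! ### Completeness -/

/-- A morphism is determined by its linear relation. -/
theorem hom_ext {f g : X ⟶ Y} (h : ev f = ev g) : f = g := by
  obtain ⟨n⟩ := Y
  induction n generalizing X with
  | zero => exact effect_ext h
  | succ n ih =>
    change X ⟶ ⟨n⟩ ⊗ wire k at f g
    have hw : ev (f ▷ wire k) = ev (g ▷ wire k) := ev_eq_iff.2 fun x y => by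
      rw [← tensorHom_id, ← tensorHom_id]
      exact rel_tensor.trans ((and_congr_left' (ev_eq_iff.1 h _ _)).trans rel_tensor.symm)
    let r := (α_ _ _ _).hom ≫ (⟨n⟩ : Syn k) ◁ cup ≫ (ρ_ _).hom
    have hr : f ▷ wire k ≫ r = g ▷ wire k ≫ r := ih (by rw [ev_comp, hw, ← ev_comp])
    rw [← unbend_bend zigzag_left f, ← unbend_bend zigzag_left g, hr]

/-- Bending the last input to an output, in terms of linear relations. -/
theorem rel_unbend {n : ℕ} {g : X ⊗ wire k ⟶ ⟨n⟩} {x : Fin X.exponent → k}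
    {y : Fin (n + 1) → k} :
    Rel (X ◁ cap ≫ (α_ _ _ _).inv ≫ g ▷ wire k) x y ↔
      Rel g (Fin.append x fun _ => y (Fin.natAdd n 0)) (fun i => y (Fin.castAdd 1 i)) := by
  have h : (α_ _ _ _).inv ≫ g ▷ wire k = g ▷ wire k := Category.id_comp _
  rw [h, rel_comp, ← tensorHom_id, ← id_tensorHom]
  constructor
  · rintro ⟨z, h, h'⟩
    obtain ⟨h₁, h₂⟩ := rel_tensor.1 h
    obtain ⟨h₃, h₄⟩ := rel_tensor.1 h'
    convert h₃ using 1
    refine (funext (Fin.addCases (fun i => ?_) fun i => ?_))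
    · rw [Fin.append_left]
      exact (congrFun h₁ i).symm
    · rw [Fin.append_right]
      exact (congrFun (rel_id.1 h₄) 0).trans ((Formal.rel_cap.1 h₂).symm.trans (by
        rw [Subsingleton.elim i 0]; rfl))
  · intro h
    let t := y (Fin.natAdd n 0)
    let u : Fin (X.exponent + 1) → k := Fin.append x fun _ => t
    let z : Fin (X.exponent + 1 + 1) → k := Fin.append u fun _ => t
    have hu : ∀ i, u (Fin.castAdd 1 i) = x i := Fin.append_left _ _
    have hu' : u (Fin.natAdd _ 0) = t := Fin.append_right _ _ 0
    have hz : ∀ i, z (Fin.castAdd 1 i) = u i := Fin.append_left _ _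
    have hz' : z (Fin.natAdd _ 0) = t := Fin.append_right _ _ 0
    refine ⟨z, rel_tensor.2 ⟨?_, ?_⟩, rel_tensor.2 ⟨?_, ?_⟩⟩
    · exact rel_id.2 (funext fun i => (hz (Fin.castAdd 1 i)).trans (hu i))
    · exact Formal.rel_cap.2 (((hz (Fin.natAdd _ 0)).trans hu').trans hz'.symm)
    · exact (funext hz : (fun i => z (Fin.castAdd 1 i)) = u) ▸ h
    · refine rel_id.2 (funext fun i => ?_)
      rw [Subsingleton.elim i 0]
      exact hz'.symm

/-- Every linear relation between powers of `k` is denoted by a morphism. -/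
theorem exists_ev_eq {m n : ℕ} (L : FinRel.pow k m ⟶ FinRel.pow k n) :
    ∃ f : (⟨m⟩ : Syn k) ⟶ ⟨n⟩, ev f = L := by
  induction n generalizing m with
  | zero =>
    -- `S` consists of the vectors that `L` relates to the empty tuple. It is the kernel of its
    -- quotient map, so it is the solution set of a system of linear equations.
    let S : Submodule k (Fin m → k) := L.rel.comap (LinearMap.inl k (Fin m → k) (Fin 0 → k))
    let b := (Module.finBasis k ((Fin m → k) ⧸ S)).equivFun
    obtain ⟨f, hf, hf'⟩ := exists_lin ⟨m⟩ ⟨_⟩ (b.toLinearMap ∘ₗ S.mkQ)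
    refine ⟨f ≫ cozeros _, FinRel.hom_ext
      fun (x : Fin m → k) (y : Fin _ → k) => ?_⟩
    obtain rfl : (0 : Fin 0 → k) = y := funext fun i => i.elim0
    have hS : b (S.mkQ x) = 0 ↔ (x, 0) ∈ L.rel := by
      rw [map_eq_zero_iff b b.injective, Submodule.mkQ_apply, Submodule.Quotient.mk_eq_zero]
      rfl
    refine rel_comp.trans (Iff.trans ?_ hS)
    constructor
    · rintro ⟨z, h, h'⟩
      exact ((hf' x z).1 h).symm.trans (rel_cozeros.1 h')
    · exact fun h => ⟨_, (hf' x _).2 rfl, rel_cozeros.2 h⟩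
  | succ n ih =>
    let e := (FinRel.appendEquiv k m 1).symm.toLinearMap ∘ₗ LinearMap.fst k _ (Fin n → k)
    let e' := (FinRel.appendEquiv k n 1).toLinearMap ∘ₗ
      (LinearMap.snd k (Fin (m + 1) → k) (Fin n → k)).prod (LinearMap.snd k _ _ ∘ₗ e)
    -- `M` is `L` with its last output bent to an input.
    let M : FinRel.pow k (m + 1) ⟶ FinRel.pow k n :=
      FinRel.Hom.mk (L.rel.comap ((LinearMap.fst k _ _ ∘ₗ e).prod e'))
    obtain ⟨g, hg⟩ := ih M
    refine ⟨(⟨m⟩ : Syn k) ◁ cap ≫ (α_ _ _ _).inv ≫ g ▷ wire k, FinRel.hom_ext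
      fun (x : Fin m → k) (y : Fin _ → k) => ?_⟩
    refine rel_unbend.trans ?_
    rw [Rel, hg]
    change (_, _) ∈ L.rel ↔ _
    have h₁ : (fun i => Fin.append x (fun _ => y (Fin.natAdd n 0)) (Fin.castAdd 1 i)) = x :=
      funext (Fin.append_left _ _)
    have h₂ : Fin.append (fun i => y (Fin.castAdd 1 i))
        (fun i => Fin.append x (fun _ => y (Fin.natAdd n 0)) (Fin.natAdd m i)) = y := by
      refine funext (Fin.addCases (fun i => ?_) fun i => ?_)
      · rw [Fin.append_left]
      · rw [Fin.append_right, Fin.append_right, Subsingleton.elim i 0]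
    exact iff_of_eq (congrArg (· ∈ L.rel) (Prod.ext h₁ h₂))

end Syn

/-- The linear relations denoted by formal morphisms are generated. -/
theorem Formal.generated_ev {k : Type u} [Field k] {m n : ℕ} (f : Formal k m n) :
    FinRel.Generated f.ev := by
  induction f with
  | gen g => exact .gen g
  | id n => exact .id n
  | comp _ _ hf hg => exact .comp hf hg
  | tensor _ _ hf hg => exact .tensor hf hg
  | braid m n => exact .braid m n

theorem FinRel.generated {k : Type u} [Field k] {m n : ℕ} (L : pow k m ⟶ pow k n) :
    Generated L := by
  obtain ⟨f, rfl⟩ := Syn.exists_ev_eq L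
  obtain ⟨f, rfl⟩ := Syn.cls_surjective f
  exact f.generated_ev

theorem theorem2 (k : Type u) [Field k] :
    (FinRel.GeneratedSubcategory.inclusion k).IsEquivalence ∧
    (∀ (m n : ℕ) (f g : Formal k m n), Formal.Relation f g → f.ev = g.ev) ∧
    (∀ (m n : ℕ) (f g : Formal k m n), f.ev = g.ev ↔ Formal.Moves f g) := by
  refine ⟨⟨⟨fun h => Subtype.ext h⟩, ⟨fun L => ⟨⟨L, FinRel.generated L⟩, rfl⟩⟩, ⟨fun V => ?_⟩⟩,
    fun m n f g => Formal.ev_eq_of_relation, fun m n f g => ⟨fun h => ?_, Formal.ev_eq_of_moves⟩⟩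
  · exact ⟨⟨_⟩, ⟨FinRel.isoOfEquiv (U := FinRel.pow k _)
      (Module.finBasis k V.carrier).equivFun.symm⟩⟩
  · exact Syn.cls_eq_cls_iff.1 (Syn.hom_ext h)
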